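/- Let $G$ be a discrete group. A partial action $\alpha=(\{A_g\}_{g\in G},\{\alpha_g\}_{g\in G})$ of $G$ on a C*-algebra $A$ consists of closed two-sided ideals $A_g\subseteq A$ and $^*$-isomorphisms $\alpha_g\colon A_{g^{-1}}\to A_g$ such that $A_e=A$, $\alpha_e=\mathrm{id}_A$, and $\alpha_{gh}$ extends $\alpha_g\circ\alpha_h$ for all $g,h\in G$. Its partial crossed product $A\rtimes_\alpha G$ is the completion of the $^*$-algebra of finite formal sums $\sum_g a_g\delta_g$ ($a_g\in A_g$), with $a\delta_g\cdot b\delta_h=\alpha_g(\alpha_g^{-1}(a)b)\delta_{gh}$ and $(a\delta_g)^*=\alpha_{g^{-1}}(a^*)\delta_{g^{-1}}$, in the norm $\|x\|_{\max}=\sup\{p(x): p\text{ a C*-seminorm}\}$. A $^*$-homomorphism $\phi\colon A\to B$ between C*-algebras with partial actions $\alpha,\beta$ of $G$ is $G$-equivariant if $\phi(A_g)\subseteq B_g$ and $\phi(\alpha_g(a))=\beta_g(\phi(a))$ for all $g\in G$, $a\in A_{g^{-1}}$. An inductive limit of a sequence of C*-algebras and $^*$-homomorphisms is a compatible family of $^*$-homomorphisms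 into a C*-algebra through which every other such family factors uniquely. **Theorem 3.4.** For $i\in\mathbb N$ let $\alpha^{(i)}$ be a partial action of $G$ on a C*-algebra $A^{(i)}$ and let $\phi_i\colon A^{(i)}\to A^{(i+1)}$ be a $G$-equivariant $^*$-homomorphism. Let $(A,(\mu_i)_{i\in\mathbb N})$ be an inductive limit of $(A^{(i)},\phi_i)_{i\in\mathbb N}$. Then there is exactly one partial action $\alpha$ of $G$ on $A$, the inductive limit partial action, such that $A_g=\overline{\bigcup_i\mu_i(A^{(i)}_g)}$ for all $g\in G$ and every $\mu_i$ is $G$-equivariant. Moreover, there are $^*$-homomorphisms $$\psi_i\colon A^{(i)}\rtimes_{\alpha^{(i)}}G\to A^{(i+1)}\rtimes_{\alpha^{(i+1)}}G,\qquad \lambda_i\colon A^{(i)}\rtimes_{\alpha^{(i)}}G\to A\rtimes_\alpha G$$ with $\psi_i(a\delta_g)=\phi_i(a)\delta_g$ and $\lambda_i(a\delta_g)=\mu_i(a)\delta_g$ for all $g\in G$, $a\in A^{(i)}_g$, such that $(A\rtimes_\alpha G,(\lambda_i)_{i\in\mathbb N})$ is an inductive limit of the inductive sequence $(A^{(i)}\rtimes_{\alpha^{(i)}}G,\psi_i)_{i\in\mathbb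 N}$. Consequently $$A\rtimes_\alpha G\cong\varinjlim A^{(i)}\rtimes_{\alpha^{(i)}}G$$ canonically: for every inductive limit $(M,(\nu_i)_{i\in\mathbb N})$ of $(A^{(i)}\rtimes_{\alpha^{(i)}}G,\psi_i)_{i\in\mathbb N}$ there is a unique $^*$-isomorphism $\theta\colon A\rtimes_\alpha G\to M$ with $\theta\circ\lambda_i=\nu_i$ for all $i$. -/

import Mathlib

open scoped DirectSum

universe u v w

/-! ### C*-seminorms and the C*-algebra obtained by completion -/

section Seminorms

/-- A C*-seminorm on a complex *-algebra `R` : a submultiplicative, *-invariant seminorm with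
`p (x* x) = p (x) ^ 2`. -/
structure CStarSeminorm (R : Type*) [NonUnitalRing R] [StarRing R] [Module ℂ R]
    extends Seminorm ℂ R where
  mul_le' : ∀ x y : R, toFun (x * y) ≤ toFun x * toFun y
  star_eq' : ∀ x : R, toFun (star x) = toFun x
  star_mul_self' : ∀ x : R, toFun (star x * x) = toFun x ^ 2

namespace CStarSeminorm

variable {R : Type*} [NonUnitalRing R] [StarRing R] [Module ℂ R]

instance : CoeFun (CStarSeminorm R) (fun _ => R → ℝ) := ⟨fun p => p.toFun⟩

lemma apply_zero (p : CStarSeminorm R) : p 0 = 0 := p.map_zero'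

lemma apply_nonneg (p : CStarSeminorm R) (x : R) : 0 ≤ p x := by
  have h : 0 ≤ p.toSeminorm x := by positivity
  exact h

/-- The zero seminorm. -/
instance : Nonempty (CStarSeminorm R) :=
  ⟨{ toSeminorm := 0
     mul_le' := fun _ _ => by change (0 : ℝ) ≤ 0 * 0; simp
     star_eq' := fun _ => rfl
     star_mul_self' := fun _ => by change (0 : ℝ) = 0 ^ 2; simp }⟩

/-- The supremum of all C*-seminorms, when it is finite at every element. -/
noncomputable def sup (R : Type*) [NonUnitalRing R] [StarRing R] [Module ℂ R]
    (h : ∀ x : R, BddAbove (Set.range fun p : CStarSeminorm R => p x)) : CStarSeminorm R where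
  toFun x := ⨆ p : CStarSeminorm R, p x
  map_zero' := by simp [apply_zero]
  add_le' x y := ciSup_le fun p => (p.add_le' x y).trans
    (add_le_add (le_ciSup (h x) p) (le_ciSup (h y) p))
  neg' x := by
    congr 1; funext p; exact p.neg' x
  smul' c x := by
    rw [Real.mul_iSup_of_nonneg (norm_nonneg c)]
    congr 1; funext p; exact p.smul' c x
  mul_le' x y := ciSup_le fun p => (p.mul_le' x y).trans
    (mul_le_mul (le_ciSup (h x) p) (le_ciSup (h y) p) (p.apply_nonneg y)
      ((p.apply_nonneg x).trans (le_ciSup (h x) p)))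
  star_eq' x := by
    congr 1; funext p; exact p.star_eq' x
  star_mul_self' x := by
    refine le_antisymm (ciSup_le fun p => ?_) ?_
    · rw [p.star_mul_self' x]
      exact pow_le_pow_left₀ (p.apply_nonneg x) (le_ciSup (h x) p) 2
    · have h0 : 0 ≤ ⨆ p : CStarSeminorm R, p (star x * x) :=
        Real.iSup_nonneg fun p => p.apply_nonneg _
      have : (⨆ p : CStarSeminorm R, p x) ≤ Real.sqrt (⨆ p : CStarSeminorm R, p (star x * x)) :=
        ciSup_le fun p => Real.le_sqrt_of_sq_le
          ((p.star_mul_self' x).symm.le.trans (le_ciSup (h (star x * x)) p))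
      calc _ ≤ Real.sqrt (⨆ p : CStarSeminorm R, p (star x * x)) ^ 2 :=
            pow_le_pow_left₀ (Real.iSup_nonneg fun p => p.apply_nonneg _) this 2
        _ = _ := Real.sq_sqrt h0

/-- A copy of `R`, equipped with the (semi)norm `p`. -/
def Carrier (_p : CStarSeminorm R) : Type _ := R

namespace Carrier

variable (p : CStarSeminorm R)

instance : NonUnitalRing p.Carrier := inferInstanceAs (NonUnitalRing R)

instance : StarRing p.Carrier := inferInstanceAs (StarRing R)

instance : Module ℂ p.Carrier := inferInstanceAs (Module ℂ R)

instance [IsScalarTower ℂ R R] : IsScalarTower ℂ p.Carrier p.Carrier :=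
  inferInstanceAs (IsScalarTower ℂ R R)

instance [SMulCommClass ℂ R R] : SMulCommClass ℂ p.Carrier p.Carrier :=
  inferInstanceAs (SMulCommClass ℂ R R)

instance [StarModule ℂ R] : StarModule ℂ p.Carrier := inferInstanceAs (StarModule ℂ R)

noncomputable instance : SeminormedAddCommGroup p.Carrier :=
  AddGroupSeminorm.toSeminormedAddCommGroup
    (E := p.Carrier) (p.toSeminorm.toAddGroupSeminorm : AddGroupSeminorm R)

lemma norm_def (x : p.Carrier) : ‖x‖ = p (x : R) := rfl

noncomputable instance : NonUnitalSeminormedRing p.Carrier :=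
  { (inferInstance : SeminormedAddCommGroup p.Carrier), (inferInstance : NonUnitalRing p.Carrier) with
    norm_mul_le := fun x y => p.mul_le' x y }

noncomputable instance : NormedSpace ℂ p.Carrier where
  norm_smul_le c x := (p.smul' c x).le

instance : NormedStarGroup p.Carrier where
  norm_star_le x := (p.star_eq' x).le

end Carrier

/-- The (Hausdorff) completion of the *-algebra `R` with respect to the C*-seminorm `p`. -/
def Completion (p : CStarSeminorm R) : Type _ := UniformSpace.Completion p.Carrier

namespace Completion

variable (p : CStarSeminorm R)

noncomputable instance : NormedAddCommGroup p.Completion :=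
  inferInstanceAs (NormedAddCommGroup (UniformSpace.Completion p.Carrier))

noncomputable instance : NormedSpace ℂ p.Completion :=
  inferInstanceAs (NormedSpace ℂ (UniformSpace.Completion p.Carrier))

instance : CompleteSpace p.Completion :=
  inferInstanceAs (CompleteSpace (UniformSpace.Completion p.Carrier))

/-- The canonical map to the completion, on the copy of `R` that carries the seminorm. -/
noncomputable def ofCarrier (x : p.Carrier) : p.Completion :=
  (x : UniformSpace.Completion p.Carrier)

/-- The canonical map from `R` to its completion. -/
noncomputable def of (x : R) : p.Completion := ofCarrier p x

lemma isDenseInducing_ofCarrier : IsDenseInducing (ofCarrier p) :=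
  UniformSpace.Completion.isDenseInducing_coe

lemma continuous_ofCarrier : Continuous (ofCarrier p) := UniformSpace.Completion.continuous_coe _

lemma denseRange_ofCarrier : DenseRange (ofCarrier p) := (isDenseInducing_ofCarrier p).dense

lemma ofCarrier_add (x y : p.Carrier) : ofCarrier p (x + y) = ofCarrier p x + ofCarrier p y :=
  UniformSpace.Completion.coe_add x y

lemma ofCarrier_smul (c : ℂ) (x : p.Carrier) : ofCarrier p (c • x) = c • ofCarrier p x :=
  UniformSpace.Completion.coe_smul c x

lemma ofCarrier_zero : ofCarrier p 0 = 0 := UniformSpace.Completion.coe_zero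

lemma norm_ofCarrier (x : p.Carrier) : ‖ofCarrier p x‖ = ‖x‖ := UniformSpace.Completion.norm_coe x

lemma eq_of_dense {f g : p.Completion → p.Completion} (hf : Continuous f) (hg : Continuous g)
    (h : ∀ a, f (ofCarrier p a) = g (ofCarrier p a)) (x : p.Completion) : f x = g x :=
  congrFun ((denseRange_ofCarrier p).equalizer hf hg (funext h)) x

lemma le_of_dense {f g : p.Completion → ℝ} (hf : Continuous f) (hg : Continuous g)
    (h : ∀ a, f (ofCarrier p a) ≤ g (ofCarrier p a)) (x : p.Completion) : f x ≤ g x :=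
  (denseRange_ofCarrier p).induction_on (p := fun x => f x ≤ g x) x (isClosed_le hf hg) h

/-- The multiplication of the completion: the continuous extension of that of `R`. -/
noncomputable instance : Mul p.Completion :=
  ⟨Function.curry (((isDenseInducing_ofCarrier p).prodMap (isDenseInducing_ofCarrier p)).extend
    (ofCarrier p ∘ Function.uncurry (· * ·)))⟩

/-- The involution of the completion: the continuous extension of that of `R`. -/
noncomputable instance : Star p.Completion :=
  ⟨(isDenseInducing_ofCarrier p).extend (fun x => ofCarrier p (star x))⟩

lemma ofCarrier_mul (x y : p.Carrier) : ofCarrier p (x * y) = ofCarrier p x * ofCarrier p y :=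
  (((isDenseInducing_ofCarrier p).prodMap (isDenseInducing_ofCarrier p)).extend_eq
      ((continuous_ofCarrier p).comp continuous_mul) (x, y)).symm

lemma ofCarrier_star (x : p.Carrier) : ofCarrier p (star x) = star (ofCarrier p x) :=
  ((isDenseInducing_ofCarrier p).extend_eq
      ((continuous_ofCarrier p).comp continuous_star) x).symm

instance : ContinuousMul p.Completion where
  continuous_mul := by
    let toC : p.Carrier →+ p.Completion :=
      ⟨⟨ofCarrier p, ofCarrier_zero p⟩, ofCarrier_add p⟩
    let m := (AddMonoidHom.mul : p.Carrier →+ p.Carrier →+ p.Carrier).compr₂ toC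
    have : Continuous fun q : p.Carrier × p.Carrier => m q.1 q.2 :=
      (continuous_ofCarrier p).comp continuous_mul
    have di : IsDenseInducing (toC : p.Carrier → p.Completion) := isDenseInducing_ofCarrier p
    exact di.extend_Z_bilin di this

instance : ContinuousStar p.Completion where
  continuous_star := by
    have h : UniformContinuous fun x : p.Carrier => ofCarrier p (star x) :=
      (UniformSpace.Completion.uniformContinuous_coe _).comp
        (star_isometry (E := p.Carrier)).uniformContinuous
    exact (uniformContinuous_uniformly_extend
      (UniformSpace.Completion.isUniformInducing_coe p.Carrier)
      (denseRange_ofCarrier p) h).continuous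

lemma mul_assoc_aux (a b c : p.Completion) : a * b * c = a * (b * c) := by
  refine eq_of_dense p (f := fun a => a * b * c) (g := fun a => a * (b * c))
    ((continuous_id.mul continuous_const).mul continuous_const)
    (continuous_id.mul continuous_const) (fun a => ?_) a
  refine eq_of_dense p (f := fun b => ofCarrier p a * b * c)
    (g := fun b => ofCarrier p a * (b * c))
    ((continuous_const.mul continuous_id).mul continuous_const)
    (continuous_const.mul (continuous_id.mul continuous_const)) (fun b => ?_) b
  refine eq_of_dense p (f := fun c => ofCarrier p a * ofCarrier p b * c)
    (g := fun c => ofCarrier p a * (ofCarrier p b * c))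
    (continuous_const.mul continuous_id)
    (continuous_const.mul (continuous_const.mul continuous_id)) (fun c => ?_) c
  simp only [← ofCarrier_mul, mul_assoc]

lemma mul_add_aux (a b c : p.Completion) : a * (b + c) = a * b + a * c := by
  refine eq_of_dense p (f := fun a => a * (b + c)) (g := fun a => a * b + a * c)
    (continuous_id.mul continuous_const)
    ((continuous_id.mul continuous_const).add (continuous_id.mul continuous_const))
    (fun a => ?_) a
  refine eq_of_dense p (f := fun b => ofCarrier p a * (b + c))
    (g := fun b => ofCarrier p a * b + ofCarrier p a * c)
    (continuous_const.mul (continuous_id.add continuous_const))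
    ((continuous_const.mul continuous_id).add continuous_const) (fun b => ?_) b
  refine eq_of_dense p (f := fun c => ofCarrier p a * (ofCarrier p b + c))
    (g := fun c => ofCarrier p a * ofCarrier p b + ofCarrier p a * c)
    (continuous_const.mul (continuous_const.add continuous_id))
    (continuous_const.add (continuous_const.mul continuous_id)) (fun c => ?_) c
  simp only [← ofCarrier_mul, ← ofCarrier_add, mul_add]

lemma star_star_aux (a : p.Completion) : star (star a) = a :=
  eq_of_dense p (f := fun a => star (star a)) (g := fun a => a)
    continuous_id.star.star continuous_id
    (fun a => by simp only [← ofCarrier_star, star_star]) a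

lemma star_mul_aux (a b : p.Completion) : star (a * b) = star b * star a := by
  refine eq_of_dense p (f := fun a => star (a * b)) (g := fun a => star b * star a)
    (continuous_id.mul continuous_const).star (continuous_const.mul continuous_id.star)
    (fun a => ?_) a
  refine eq_of_dense p (f := fun b => star (ofCarrier p a * b))
    (g := fun b => star b * star (ofCarrier p a))
    (continuous_const.mul continuous_id).star (continuous_id.star.mul continuous_const)
    (fun b => ?_) b
  simp only [← ofCarrier_star, ← ofCarrier_mul, star_mul]

lemma star_add_aux (a b : p.Completion) : star (a + b) = star a + star b := by
  refine eq_of_dense p (f := fun a => star (a + b)) (g := fun a => star a + star b)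
    (continuous_id.add continuous_const).star (continuous_id.star.add continuous_const)
    (fun a => ?_) a
  refine eq_of_dense p (f := fun b => star (ofCarrier p a + b))
    (g := fun b => star (ofCarrier p a) + star b)
    (continuous_const.add continuous_id).star (continuous_const.add continuous_id.star)
    (fun b => ?_) b
  simp only [← ofCarrier_star, ← ofCarrier_add, star_add]

lemma add_mul_aux (a b c : p.Completion) : (a + b) * c = a * c + b * c := by
  rw [← star_star_aux p ((a + b) * c), star_mul_aux, star_add_aux, mul_add_aux, star_add_aux,
    ← star_mul_aux, ← star_mul_aux, star_star_aux, star_star_aux]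

lemma norm_mul_le_aux (a b : p.Completion) : ‖a * b‖ ≤ ‖a‖ * ‖b‖ := by
  refine le_of_dense p (f := fun a => ‖a * b‖) (g := fun a => ‖a‖ * ‖b‖)
    (continuous_id.mul continuous_const).norm (continuous_norm.mul continuous_const)
    (fun a => ?_) a
  refine le_of_dense p (f := fun b => ‖ofCarrier p a * b‖) (g := fun b => ‖ofCarrier p a‖ * ‖b‖)
    (continuous_const.mul continuous_id).norm (continuous_const.mul continuous_norm)
    (fun b => ?_) b
  simp only [← ofCarrier_mul, norm_ofCarrier]
  exact norm_mul_le a b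

lemma norm_mul_self_le_aux (a : p.Completion) : ‖a‖ * ‖a‖ ≤ ‖star a * a‖ := by
  refine le_of_dense p (f := fun a => ‖a‖ * ‖a‖) (g := fun a => ‖star a * a‖)
    (continuous_norm.mul continuous_norm) (continuous_id.star.mul continuous_id).norm
    (fun a => ?_) a
  simp only [← ofCarrier_star, ← ofCarrier_mul, norm_ofCarrier]
  exact le_of_eq ((pow_two _).symm.trans (p.star_mul_self' a).symm)

lemma smul_mul_aux [IsScalarTower ℂ R R] (c : ℂ) (a b : p.Completion) :
    c • a * b = c • (a * b) := by
  refine eq_of_dense p (f := fun a => c • a * b) (g := fun a => c • (a * b))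
    ((continuous_const_smul c).mul continuous_const)
    ((continuous_id.mul continuous_const).const_smul c) (fun a => ?_) a
  refine eq_of_dense p (f := fun b => c • ofCarrier p a * b)
    (g := fun b => c • (ofCarrier p a * b))
    (continuous_const.mul continuous_id)
    ((continuous_const.mul continuous_id).const_smul c) (fun b => ?_) b
  simp only [← ofCarrier_smul, ← ofCarrier_mul, smul_mul_assoc]

lemma mul_smul_aux [SMulCommClass ℂ R R] (c : ℂ) (a b : p.Completion) :
    a * c • b = c • (a * b) := by
  refine eq_of_dense p (f := fun a => a * c • b) (g := fun a => c • (a * b))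
    (continuous_id.mul continuous_const)
    ((continuous_id.mul continuous_const).const_smul c) (fun a => ?_) a
  refine eq_of_dense p (f := fun b => ofCarrier p a * c • b)
    (g := fun b => c • (ofCarrier p a * b))
    (continuous_const.mul (continuous_const_smul c))
    ((continuous_const.mul continuous_id).const_smul c) (fun b => ?_) b
  simp only [← ofCarrier_smul, ← ofCarrier_mul, mul_smul_comm]

lemma star_smul_aux [StarModule ℂ R] (c : ℂ) (a : p.Completion) :
    star (c • a) = star c • star a := by
  refine eq_of_dense p (f := fun a => star (c • a)) (g := fun a => star c • star a)
    (continuous_const_smul c).star (continuous_id.star.const_smul (star c)) (fun a => ?_) a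
  simp only [← ofCarrier_smul, ← ofCarrier_star, star_smul]

noncomputable instance : NonUnitalNormedRing p.Completion :=
  { (inferInstance : NormedAddCommGroup p.Completion), (inferInstance : Mul p.Completion) with
    zero_mul := fun a => by
      have h := add_mul_aux p 0 0 a
      rw [add_zero] at h
      exact left_eq_add.mp h
    mul_zero := fun a => by
      have h := mul_add_aux p a 0 0
      rw [add_zero] at h
      exact left_eq_add.mp h
    mul_assoc := mul_assoc_aux p
    left_distrib := mul_add_aux p
    right_distrib := add_mul_aux p
    norm_mul_le := norm_mul_le_aux p }

noncomputable instance : StarRing p.Completion where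
  star_involutive := star_star_aux p
  star_mul := star_mul_aux p
  star_add := star_add_aux p

section

variable [IsScalarTower ℂ R R] [SMulCommClass ℂ R R] [StarModule ℂ R]

/-- The completion of a *-algebra with respect to a C*-seminorm is a C*-algebra. -/
noncomputable instance : NonUnitalCStarAlgebra p.Completion where
  norm_mul_self_le := norm_mul_self_le_aux p
  smul_assoc := smul_mul_aux p
  smul_comm c a b := (mul_smul_aux p c a b).symm
  star_smul := star_smul_aux p

/-- The canonical map from `R` to its completion, as a *-homomorphism. -/
noncomputable def ofHom : R →⋆ₙₐ[ℂ] p.Completion where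
  toFun := of p
  map_smul' := ofCarrier_smul p
  map_zero' := ofCarrier_zero p
  map_add' := ofCarrier_add p
  map_mul' := ofCarrier_mul p
  map_star' := ofCarrier_star p

end

end Completion

/-- On a C*-algebra every C*-seminorm is dominated by the norm. -/
lemma le_norm {A : Type*} [NonUnitalCStarAlgebra A] (p : CStarSeminorm A) (a : A) :
    p a ≤ ‖a‖ := by
  have h := NonUnitalStarAlgHom.norm_apply_le (F := A →⋆ₙₐ[ℂ] p.Completion) (Completion.ofHom p) a
  rwa [show ‖Completion.ofHom p a‖ = p a from Completion.norm_ofCarrier p a] at h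

end CStarSeminorm

end Seminorms

/-! ### Partial actions -/

section Shortcuts

/- Shortcut instances, for the speed of instance search only. -/

variable {A : Type*} [NonUnitalCStarAlgebra A] (S : NonUnitalStarSubalgebra ℂ A)

instance : NonUnitalRing S := inferInstance
instance : AddCommGroup S := inferInstance
instance : AddCommMonoid S := inferInstance
instance : AddMonoid S := inferInstance
instance : AddZeroClass S := inferInstance
instance : Add S := inferInstance
instance : Mul S := inferInstance
instance : Module ℂ S := inferInstance
instance : SMul ℂ S := inferInstance
instance : Star S := inferInstance

end Shortcuts

section PartialActions

/-- A partial action of a (discrete) group `G` on a C*-algebra `A` : closed two-sided ideals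
`A_g` of `A` and *-isomorphisms `α_g : A_{g⁻¹} → A_g` such that `A_1 = A`, `α_1 = id` and
`α_{gh}` extends `α_g ∘ α_h`.  (A closed two-sided ideal of a C*-algebra is automatically a
complex subspace stable under `star`, so it is recorded as a *-subalgebra that is closed and
absorbs multiplication on both sides.) -/
structure PartialAction (G : Type v) [Group G] (A : Type u) [NonUnitalCStarAlgebra A] where
  /-- The ideal `A_g`. -/
  ideal : G → NonUnitalStarSubalgebra ℂ A
  isClosed_ideal : ∀ g, IsClosed (ideal g : Set A)
  mul_mem_left : ∀ g (a x : A), x ∈ ideal g → a * x ∈ ideal g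
  mul_mem_right : ∀ g (x a : A), x ∈ ideal g → x * a ∈ ideal g
  /-- The *-isomorphism `α_g : A_{g⁻¹} → A_g`. -/
  map : ∀ g, ideal g⁻¹ ≃⋆ₐ[ℂ] ideal g
  ideal_one : ideal 1 = ⊤
  map_one : ∀ x : ideal 1⁻¹, (map 1 x : A) = x
  map_comp : ∀ (g h : G) (x : ideal h⁻¹) (hx : (map h x : A) ∈ ideal g⁻¹),
    ∃ hx' : (x : A) ∈ ideal (g * h)⁻¹, (map (g * h) ⟨x, hx'⟩ : A) = map g ⟨map h x, hx⟩

namespace PartialAction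

variable {G : Type v} [Group G] {A : Type u} [NonUnitalCStarAlgebra A] (α : PartialAction G A)

lemma mem_ideal_one (a : A) : a ∈ α.ideal 1 := by
  rw [α.ideal_one]; exact NonUnitalStarAlgebra.mem_top

lemma map_congr {g h : G} (e : g = h) {x y : A} (hx : x ∈ α.ideal g⁻¹) (hy : y ∈ α.ideal h⁻¹)
    (hxy : x = y) : (α.map g ⟨x, hx⟩ : A) = α.map h ⟨y, hy⟩ := by
  subst e; subst hxy; rfl

/-- `α_{g⁻¹} = α_g⁻¹`. -/
lemma map_inv (g : G) (x : α.ideal g) (hx : (x : A) ∈ α.ideal g⁻¹⁻¹) :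
    (α.map g⁻¹ ⟨x, hx⟩ : A) = (α.map g).symm x := by
  have h1 : (α.map g ((α.map g).symm x) : A) = x := by simp
  obtain ⟨h2, h3⟩ := α.map_comp g⁻¹ g ((α.map g).symm x) (by rw [h1]; exact hx)
  rw [α.map_congr rfl hx (y := (α.map g ((α.map g).symm x) : A)) (by rw [h1]; exact hx) h1.symm,
    ← h3]
  have h4 : ((α.map g).symm x : A) ∈ α.ideal 1⁻¹ := by
    rw [inv_one]; exact α.mem_ideal_one _
  rw [α.map_congr (inv_mul_cancel g) h2 h4 rfl]
  exact α.map_one ⟨_, h4⟩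

lemma map_inv_symm (g : G) (x : α.ideal g⁻¹) :
    ((α.map g⁻¹).symm x : A) = α.map g x := by
  have hx : ((α.map g x : α.ideal g) : A) ∈ α.ideal g⁻¹⁻¹ := by
    rw [inv_inv]; exact (α.map g x).2
  have h : α.map g⁻¹ ⟨α.map g x, hx⟩ = x := by
    apply Subtype.ext
    rw [α.map_inv g (α.map g x) hx]
    simp
  conv_lhs => rw [← h]
  simp

/-- `α_g (A_{g⁻¹} ∩ A_h) ⊆ A_{gh}`, and `α_{gh}⁻¹ ∘ α_g = α_h⁻¹` there. -/
lemma symm_map (g h : G) (x : A) (hg : x ∈ α.ideal g⁻¹) (hh : x ∈ α.ideal h) :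
    ∃ hx : (α.map g ⟨x, hg⟩ : A) ∈ α.ideal (g * h),
      ((α.map (g * h)).symm ⟨α.map g ⟨x, hg⟩, hx⟩ : A) = (α.map h).symm ⟨x, hh⟩ := by
  have h1 : (α.map h ((α.map h).symm ⟨x, hh⟩) : A) = x := by simp
  obtain ⟨h2, h3⟩ := α.map_comp g h ((α.map h).symm ⟨x, hh⟩) (by rw [h1]; exact hg)
  have h4 : (α.map (g * h) ⟨_, h2⟩ : A) = α.map g ⟨x, hg⟩ :=
    h3.trans (α.map_congr rfl _ _ h1)
  refine ⟨h4 ▸ (α.map (g * h) ⟨_, h2⟩).2, ?_⟩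
  have h5 : (⟨α.map g ⟨x, hg⟩, h4 ▸ (α.map (g * h) ⟨_, h2⟩).2⟩ : α.ideal (g * h))
      = α.map (g * h) ⟨_, h2⟩ := Subtype.ext h4.symm
  rw [h5]; simp

/-- The product `a δ_g · b δ_h = α_g (α_g⁻¹ (a) b) δ_{gh}` of two homogeneous elements. -/
noncomputable def mulAux (g h : G) (a : α.ideal g) (b : α.ideal h) : α.ideal (g * h) :=
  ⟨α.map g ⟨(α.map g).symm a * b, α.mul_mem_right _ _ _ ((α.map g).symm a).2⟩,
    (α.symm_map g h _ _ (α.mul_mem_left _ _ _ b.2)).1⟩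

/-- The adjoint `(a δ_g)* = α_{g⁻¹} (a*) δ_{g⁻¹}` of a homogeneous element. -/
noncomputable def starAux (g : G) (a : α.ideal g) : α.ideal g⁻¹ := (α.map g).symm (star a)

lemma symm_map_mul_left (h : G) (b : α.ideal h) (c : A) (v : α.ideal h⁻¹) :
    ∀ hm, (α.map h ⟨(α.map h).symm b * c, hm⟩ : A) * α.map h v
      = b * α.map h ⟨c * v, α.mul_mem_left _ _ _ v.2⟩ := by
  intro hm
  have e : (⟨(α.map h).symm b * c, hm⟩ : α.ideal h⁻¹) * v
      = (α.map h).symm b * ⟨c * v, α.mul_mem_left _ _ _ v.2⟩ := Subtype.ext (mul_assoc _ _ _)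
  have := congrArg (fun z => (α.map h z : A)) e
  simpa using this

/-- `α_h (α_h⁻¹ (a b) c) = a α_h (α_h⁻¹ (b) c)` for `a, c ∈ A` and `b ∈ A_h`. -/
lemma map_symm_mul (h : G) (a : A) (b : α.ideal h) (c : A) :
    (α.map h ⟨(α.map h).symm ⟨a * b, α.mul_mem_left _ _ _ b.2⟩ * c,
        α.mul_mem_right _ _ _ ((α.map h).symm _).2⟩ : A)
      = a * α.map h ⟨(α.map h).symm b * c, α.mul_mem_right _ _ _ ((α.map h).symm _).2⟩ := by
  set p : α.ideal h := α.map h ⟨(α.map h).symm ⟨a * b, α.mul_mem_left _ _ _ b.2⟩ * c,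
        α.mul_mem_right _ _ _ ((α.map h).symm _).2⟩ with hp
  set q : α.ideal h := α.map h ⟨(α.map h).symm b * c,
    α.mul_mem_right _ _ _ ((α.map h).symm _).2⟩ with hq
  have key (w : α.ideal h) : ((p : A) - a * q) * w = 0 := by
    have hw : (w : A) = α.map h ((α.map h).symm w) := by simp
    rw [hw, sub_mul, mul_assoc, hp, hq, symm_map_mul_left, symm_map_mul_left, ← mul_assoc,
      sub_self]
  have hz : (p : A) - a * q ∈ α.ideal h := sub_mem p.2 (α.mul_mem_left _ _ _ q.2)
  have := key (star ⟨_, hz⟩)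
  exact sub_eq_zero.mp ((CStarRing.mul_star_self_eq_zero_iff _).mp this)

lemma mulAux_assoc (g h k : G) (a : α.ideal g) (b : α.ideal h) (c : α.ideal k) :
    (α.mulAux (g * h) k (α.mulAux g h a b) c : A) = α.mulAux g (h * k) a (α.mulAux h k b c) := by
  obtain ⟨h1, h2⟩ := α.symm_map g h ((α.map g).symm a * b)
    (α.mul_mem_right _ _ _ ((α.map g).symm a).2) (α.mul_mem_left _ _ _ b.2)
  have hm : ((α.map h).symm ⟨((α.map g).symm a : A) * b, α.mul_mem_left _ _ _ b.2⟩ : A) * c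
      ∈ α.ideal h⁻¹ := α.mul_mem_right _ _ _ ((α.map h).symm _).2
  have h3 := α.map_symm_mul h ((α.map g).symm a) b c
  have h4 : (α.map h ⟨_, hm⟩ : A) ∈ α.ideal g⁻¹ := by
    rw [h3]; exact α.mul_mem_right _ _ _ ((α.map g).symm a).2
  obtain ⟨h5, h6⟩ := α.map_comp g h ⟨_, hm⟩ h4
  have e : ((α.map (g * h)).symm (α.mulAux g h a b) : A) * c
      = ((α.map h).symm ⟨((α.map g).symm a : A) * b, α.mul_mem_left _ _ _ b.2⟩ : A) * c :=
    congrArg (· * (c : A)) h2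
  calc (α.mulAux (g * h) k (α.mulAux g h a b) c : A)
      = α.map (g * h) ⟨_, h5⟩ :=
        α.map_congr rfl (α.mul_mem_right _ _ _ ((α.map (g * h)).symm _).2) h5 e
    _ = α.map g ⟨_, h4⟩ := h6
    _ = _ := α.map_congr rfl _ _ h3

lemma starAux_mulAux (g h : G) (a : α.ideal g) (b : α.ideal h) :
    (α.starAux (g * h) (α.mulAux g h a b) : A)
      = α.mulAux h⁻¹ g⁻¹ (α.starAux h b) (α.starAux g a) := by
  have hm1 : ((star b : α.ideal h) : A) * ((α.map g).symm (star a)) ∈ α.ideal g⁻¹ :=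
    α.mul_mem_left _ _ _ ((α.map g).symm _).2
  have hm2 : ((star b : α.ideal h) : A) * ((α.map g).symm (star a)) ∈ α.ideal h :=
    α.mul_mem_right _ _ _ (star b).2
  obtain ⟨h1, h2⟩ := α.symm_map g h _ hm1 hm2
  have e1 : (star (α.mulAux g h a b) : α.ideal (g * h)) = ⟨α.map g ⟨_, hm1⟩, h1⟩ := by
    apply Subtype.ext
    have e3 : star (⟨(α.map g).symm a * b, α.mul_mem_right _ _ _ ((α.map g).symm a).2⟩ :
        α.ideal g⁻¹) = ⟨_, hm1⟩ := by
      apply Subtype.ext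
      simp [map_star]
    change star (α.map g ⟨(α.map g).symm a * b, _⟩ : A) = _
    exact congrArg Subtype.val
      ((map_star (α.map g) _).symm.trans (congrArg (α.map g) e3))
  have hm3 : ((star b : α.ideal h) : A) * ((α.map g).symm (star a)) ∈ α.ideal h⁻¹⁻¹ := by
    rw [inv_inv]; exact hm2
  have e2 : ((α.map h⁻¹).symm (α.starAux h b) : A) = (star b : α.ideal h) := by
    rw [map_inv_symm]; simp [starAux]
  calc (α.starAux (g * h) (α.mulAux g h a b) : A) = (α.map h).symm ⟨_, hm2⟩ := by
        rw [starAux, e1, h2]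
    _ = α.map h⁻¹ ⟨_, hm3⟩ := (α.map_inv h ⟨_, hm2⟩ hm3).symm
    _ = _ := α.map_congr rfl _ _ (by rw [e2]; rfl)

lemma starAux_starAux (g : G) (a : α.ideal g) : (α.starAux g⁻¹ (α.starAux g a) : A) = a := by
  have : star (α.starAux g a) = (α.map g).symm a := by simp [starAux, map_star]
  rw [starAux, this, map_inv_symm]; simp

lemma mulAux_starAux (g : G) (a : α.ideal g) :
    (α.mulAux g g⁻¹ a (α.starAux g a) : A) = a * star (a : A) := by
  have : (⟨(α.map g).symm a * (α.starAux g a : A), α.mul_mem_right _ _ _ ((α.map g).symm a).2⟩ :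
      α.ideal g⁻¹) = (α.map g).symm (a * star a) := by
    apply Subtype.ext; simp [starAux]
  rw [mulAux]
  simp only [this]
  simp

lemma mulAux_add_left (g h : G) (a a' : α.ideal g) (b : α.ideal h) :
    α.mulAux g h (a + a') b = α.mulAux g h a b + α.mulAux g h a' b := by
  apply Subtype.ext
  have : (⟨(α.map g).symm (a + a') * b, α.mul_mem_right _ _ _ ((α.map g).symm _).2⟩ : α.ideal g⁻¹)
      = ⟨(α.map g).symm a * b, α.mul_mem_right _ _ _ ((α.map g).symm _).2⟩
        + ⟨(α.map g).symm a' * b, α.mul_mem_right _ _ _ ((α.map g).symm _).2⟩ := by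
    apply Subtype.ext; simp [add_mul]
  have h := congrArg Subtype.val ((congrArg (α.map g) this).trans (map_add (α.map g) _ _))
  exact h

lemma mulAux_add_right (g h : G) (a : α.ideal g) (b b' : α.ideal h) :
    α.mulAux g h a (b + b') = α.mulAux g h a b + α.mulAux g h a b' := by
  apply Subtype.ext
  have : (⟨(α.map g).symm a * ((b + b' : α.ideal h) : A),
        α.mul_mem_right _ _ _ ((α.map g).symm _).2⟩ : α.ideal g⁻¹)
      = ⟨(α.map g).symm a * b, α.mul_mem_right _ _ _ ((α.map g).symm _).2⟩
        + ⟨(α.map g).symm a * b', α.mul_mem_right _ _ _ ((α.map g).symm _).2⟩ := by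
    apply Subtype.ext; simp [mul_add]
  have h := congrArg Subtype.val ((congrArg (α.map g) this).trans (map_add (α.map g) _ _))
  exact h

lemma mulAux_smul_left (g h : G) (c : ℂ) (a : α.ideal g) (b : α.ideal h) :
    α.mulAux g h (c • a) b = c • α.mulAux g h a b := by
  apply Subtype.ext
  have : (⟨(α.map g).symm (c • a) * b, α.mul_mem_right _ _ _ ((α.map g).symm _).2⟩ : α.ideal g⁻¹)
      = c • ⟨(α.map g).symm a * b, α.mul_mem_right _ _ _ ((α.map g).symm _).2⟩ := by
    apply Subtype.ext; simp [map_smul, smul_mul_assoc]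
  have h := congrArg Subtype.val ((congrArg (α.map g) this).trans (map_smul (α.map g) c _))
  exact h

lemma mulAux_smul_right (g h : G) (c : ℂ) (a : α.ideal g) (b : α.ideal h) :
    α.mulAux g h a (c • b) = c • α.mulAux g h a b := by
  apply Subtype.ext
  have : (⟨(α.map g).symm a * ((c • b : α.ideal h) : A),
        α.mul_mem_right _ _ _ ((α.map g).symm _).2⟩ : α.ideal g⁻¹)
      = c • ⟨(α.map g).symm a * b, α.mul_mem_right _ _ _ ((α.map g).symm _).2⟩ := by
    apply Subtype.ext; simp [mul_smul_comm]
  have h := congrArg Subtype.val ((congrArg (α.map g) this).trans (map_smul (α.map g) c _))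
  exact h

/-! ### The algebraic crossed product -/

/-- The *-algebra `A ⋊_alg G` of finite formal sums `∑ a_g δ_g` with `a_g ∈ A_g`. -/
def AlgCrossedProduct : Type (max v u) := ⨁ g : G, α.ideal g

namespace AlgCrossedProduct

noncomputable instance : AddCommGroup α.AlgCrossedProduct :=
  inferInstanceAs (AddCommGroup (⨁ g : G, α.ideal g))

noncomputable instance : Module ℂ α.AlgCrossedProduct :=
  inferInstanceAs (Module ℂ (⨁ g : G, α.ideal g))

open scoped Classical in
/-- The element `a δ_g` of `A ⋊_alg G`, linear in `a ∈ A_g`. -/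
noncomputable def δ (g : G) : α.ideal g →ₗ[ℂ] α.AlgCrossedProduct :=
  DirectSum.lof ℂ G (fun g => α.ideal g) g

variable {α} in
lemma δ_congr {g h : G} (e : g = h) {a : α.ideal g} {b : α.ideal h} (hab : (a : A) = b) :
    δ α g a = δ α h b := by
  subst e; rw [Subtype.ext hab]

variable {α} in
@[elab_as_elim]
lemma ind {P : α.AlgCrossedProduct → Prop} (x : α.AlgCrossedProduct) (h0 : P 0)
    (hδ : ∀ g a, P (δ α g a)) (hadd : ∀ x y, P x → P y → P (x + y)) : P x := by
  classical
  refine DirectSum.induction_on (motive := P) x h0 (fun g a => ?_) hadd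
  have e : δ α g a = DirectSum.of (fun g => α.ideal g) g a := rfl
  exact e ▸ hδ g a

open scoped Classical in
/-- The linear map on `A ⋊_alg G` with prescribed restrictions to the summands `A_g δ_g`. -/
noncomputable def lift {N : Type*} [AddCommMonoid N] [Module ℂ N]
    (f : ∀ g, α.ideal g →ₗ[ℂ] N) : α.AlgCrossedProduct →ₗ[ℂ] N :=
  DirectSum.toModule ℂ G N f

lemma lift_δ {N : Type*} [AddCommMonoid N] [Module ℂ N] (f : ∀ g, α.ideal g →ₗ[ℂ] N)
    (g : G) (a : α.ideal g) : lift α f (δ α g a) = f g a := by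
  classical
  exact DirectSum.toModule_lof (M := fun g => α.ideal g) (φ := f) ℂ g a

open scoped Classical in
/-- The additive map on `A ⋊_alg G` with prescribed restrictions to the summands `A_g δ_g`. -/
noncomputable def liftAdd {N : Type*} [AddCommMonoid N]
    (f : ∀ g, α.ideal g →+ N) : α.AlgCrossedProduct →+ N :=
  DirectSum.toAddMonoid f

lemma liftAdd_δ {N : Type*} [AddCommMonoid N] (f : ∀ g, α.ideal g →+ N)
    (g : G) (a : α.ideal g) : liftAdd α f (δ α g a) = f g a := by
  classical
  exact DirectSum.toAddMonoid_of f g a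

/-- `(a, b) ↦ a δ_g · b δ_h`, as a bilinear map. -/
noncomputable def mulδ (g h : G) : α.ideal g →ₗ[ℂ] α.ideal h →ₗ[ℂ] α.AlgCrossedProduct :=
  LinearMap.mk₂ ℂ (fun a b => δ α (g * h) (α.mulAux g h a b))
    (fun a a' b => by rw [mulAux_add_left, map_add])
    (fun c a b => by rw [mulAux_smul_left, map_smul])
    (fun a b b' => by rw [mulAux_add_right, map_add])
    (fun c a b => by rw [mulAux_smul_right, map_smul])

/-- The bilinear extension of `(a δ_g, b δ_h) ↦ α_g (α_g⁻¹ (a) b) δ_{gh}`. -/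
noncomputable def mulHom :
    α.AlgCrossedProduct →ₗ[ℂ] α.AlgCrossedProduct →ₗ[ℂ] α.AlgCrossedProduct :=
  lift α fun g => LinearMap.flip (lift α fun h => LinearMap.flip (mulδ α g h))

noncomputable instance : Mul α.AlgCrossedProduct := ⟨fun x y => mulHom α x y⟩

lemma δ_mul_δ (g h : G) (a : α.ideal g) (b : α.ideal h) :
    δ α g a * δ α h b = δ α (g * h) (α.mulAux g h a b) := by
  change mulHom α (δ α g a) (δ α h b) = _
  unfold mulHom
  rw [lift_δ, LinearMap.flip_apply, lift_δ]
  rfl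

lemma add_mul' (x y z : α.AlgCrossedProduct) : (x + y) * z = x * z + y * z :=
  LinearMap.map_add₂ (mulHom α) x y z

lemma mul_add' (x y z : α.AlgCrossedProduct) : x * (y + z) = x * y + x * z :=
  map_add (mulHom α x) y z

lemma zero_mul' (x : α.AlgCrossedProduct) : 0 * x = 0 := LinearMap.map_zero₂ (mulHom α) x

lemma mul_zero' (x : α.AlgCrossedProduct) : x * 0 = 0 := map_zero (mulHom α x)

lemma mul_assoc' (x y z : α.AlgCrossedProduct) : x * y * z = x * (y * z) := by
  induction x using ind with
  | h0 => simp only [zero_mul']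
  | hadd x x' hx hx' => simp only [add_mul', hx, hx']
  | hδ g a =>
    induction y using ind with
    | h0 => simp only [zero_mul', mul_zero']
    | hadd y y' hy hy' => simp only [add_mul', mul_add', hy, hy']
    | hδ h b =>
      induction z using ind with
      | h0 => simp only [mul_zero']
      | hadd z z' hz hz' => simp only [mul_add', hz, hz']
      | hδ k c =>
        simp only [δ_mul_δ]
        exact δ_congr (mul_assoc g h k) (α.mulAux_assoc g h k a b c)

noncomputable instance : NonUnitalRing α.AlgCrossedProduct :=
  { (inferInstance : AddCommGroup α.AlgCrossedProduct),
    (inferInstance : Mul α.AlgCrossedProduct) with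
    left_distrib := mul_add' α
    right_distrib := add_mul' α
    zero_mul := zero_mul' α
    mul_zero := mul_zero' α
    mul_assoc := mul_assoc' α }

instance : IsScalarTower ℂ α.AlgCrossedProduct α.AlgCrossedProduct where
  smul_assoc c x y := LinearMap.map_smul₂ (mulHom α) c x y

instance : SMulCommClass ℂ α.AlgCrossedProduct α.AlgCrossedProduct where
  smul_comm c x y := (map_smul (mulHom α x) c y).symm

/-- `a ↦ (a δ_g)*`. -/
noncomputable def starδ (g : G) : α.ideal g →+ α.AlgCrossedProduct where
  toFun a := δ α g⁻¹ (α.starAux g a)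
  map_zero' := by simp [starAux]
  map_add' a b := by simp [starAux]

/-- The additive extension of `a δ_g ↦ α_{g⁻¹} (a*) δ_{g⁻¹}`. -/
noncomputable def starHom : α.AlgCrossedProduct →+ α.AlgCrossedProduct :=
  liftAdd α (starδ α)

noncomputable instance : Star α.AlgCrossedProduct := ⟨starHom α⟩

lemma star_δ (g : G) (a : α.ideal g) : star (δ α g a) = δ α g⁻¹ (α.starAux g a) := by
  exact liftAdd_δ α (starδ α) g a

lemma star_add' (x y : α.AlgCrossedProduct) : star (x + y) = star x + star y :=
  map_add (starHom α) x y

lemma star_zero' : star (0 : α.AlgCrossedProduct) = 0 := map_zero (starHom α)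

noncomputable instance : StarRing α.AlgCrossedProduct where
  star_involutive x := by
    induction x using ind with
    | h0 => simp only [star_zero']
    | hadd x y hx hy => simp only [star_add', hx, hy]
    | hδ g a =>
      simp only [star_δ]
      exact δ_congr (inv_inv g) (α.starAux_starAux g a)
  star_mul x y := by
    induction x using ind with
    | h0 => simp only [star_zero', zero_mul, mul_zero]
    | hadd x x' hx hx' => simp only [star_add', add_mul, mul_add, hx, hx']
    | hδ g a =>
      induction y using ind with
      | h0 => simp only [star_zero', zero_mul, mul_zero]
      | hadd y y' hy hy' => simp only [star_add', add_mul, mul_add, hy, hy']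
      | hδ h b =>
        simp only [star_δ, δ_mul_δ]
        exact δ_congr (mul_inv_rev g h) (α.starAux_mulAux g h a b)
  star_add := star_add' α

instance : StarModule ℂ α.AlgCrossedProduct where
  star_smul c x := by
    induction x using ind with
    | h0 => simp only [smul_zero, star_zero']
    | hadd x y hx hy => simp only [smul_add, star_add', hx, hy]
    | hδ g a =>
      rw [← map_smul, star_δ, star_δ, ← map_smul]
      simp [starAux, star_smul]

/-- The embedding `a ↦ a δ_1` of `A`. -/
noncomputable def δone : A →⋆ₙₐ[ℂ] α.AlgCrossedProduct where
  toFun a := δ α 1 ⟨a, α.mem_ideal_one a⟩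
  map_smul' c a := map_smul (δ α 1) c ⟨a, α.mem_ideal_one a⟩
  map_zero' := map_zero (δ α 1)
  map_add' a b := map_add (δ α 1) ⟨a, α.mem_ideal_one a⟩ ⟨b, α.mem_ideal_one b⟩
  map_mul' a b := by
    have h (x : α.ideal 1) : ((α.map 1).symm x : A) = x := by
      have := α.map_one ((α.map 1).symm x)
      simpa using this.symm
    rw [δ_mul_δ]
    refine δ_congr (mul_one 1).symm ?_
    change a * b = _
    rw [mulAux]
    simp only [h]
    exact (α.map_one ⟨a * b, _⟩).symm
  map_star' a := by
    have h (x : α.ideal 1) : ((α.map 1).symm x : A) = x := by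
      have := α.map_one ((α.map 1).symm x)
      simpa using this.symm
    rw [star_δ]
    exact δ_congr inv_one.symm (h _).symm

/-- A C*-seminorm composed with `a ↦ a δ_1`. -/
noncomputable def restrictSeminorm (p : CStarSeminorm α.AlgCrossedProduct) : CStarSeminorm A where
  toFun a := p (δone α a)
  map_zero' := by rw [map_zero]; exact p.apply_zero
  add_le' a b := by rw [map_add]; exact p.add_le' _ _
  neg' a := by rw [map_neg]; exact p.neg' _
  smul' c a := by rw [map_smul]; exact p.smul' _ _
  mul_le' a b := by rw [map_mul]; exact p.mul_le' _ _
  star_eq' a := by rw [map_star]; exact p.star_eq' _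
  star_mul_self' a := by rw [map_mul, map_star]; exact p.star_mul_self' _

/-- `p (a δ_g) ≤ ‖a‖` for every C*-seminorm `p`. -/
lemma seminorm_δ_le (p : CStarSeminorm α.AlgCrossedProduct) (g : G) (a : α.ideal g) :
    p (δ α g a) ≤ ‖(a : A)‖ := by
  have h1 : δ α g a * star (δ α g a) = δone α (a * star (a : A)) := by
    rw [star_δ, δ_mul_δ]
    exact δ_congr (mul_inv_cancel g) (α.mulAux_starAux g a)
  have h2 : p (δ α g a) ^ 2 ≤ ‖(a : A)‖ ^ 2 := by
    have h3 := p.star_mul_self' (star (δ α g a))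
    rw [star_star, p.star_eq', h1] at h3
    have h4 := (restrictSeminorm α p).le_norm (a * star (a : A))
    rw [CStarRing.norm_self_mul_star, ← pow_two] at h4
    exact h3.symm.le.trans h4
  exact le_of_sq_le_sq h2 (norm_nonneg _)

/-- The values of all C*-seminorms at an element of `A ⋊_alg G` are bounded. -/
lemma bddAbove_seminorms (x : α.AlgCrossedProduct) :
    BddAbove (Set.range fun p : CStarSeminorm α.AlgCrossedProduct => p x) := by
  induction x using ind with
  | h0 => exact ⟨0, by rintro _ ⟨p, rfl⟩; exact p.apply_zero.le⟩
  | hδ g a => exact ⟨‖(a : A)‖, by rintro _ ⟨p, rfl⟩; exact seminorm_δ_le α p g a⟩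
  | hadd x y hx hy =>
    obtain ⟨C, hC⟩ := hx
    obtain ⟨D, hD⟩ := hy
    refine ⟨C + D, ?_⟩
    rintro _ ⟨p, rfl⟩
    exact (p.add_le' x y).trans (add_le_add (hC ⟨p, rfl⟩) (hD ⟨p, rfl⟩))

/-- The norm `‖x‖_max = sup {p x : p a C*-seminorm on A ⋊_alg G}`. -/
noncomputable def maxNorm : CStarSeminorm α.AlgCrossedProduct :=
  CStarSeminorm.sup _ (bddAbove_seminorms α)

end AlgCrossedProduct

/-! ### The partial crossed product -/

/-- The partial crossed product `A ⋊_α G` : the completion of `A ⋊_alg G` for `‖·‖_max`. -/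
def CrossedProduct : Type (max v u) := (AlgCrossedProduct.maxNorm α).Completion

namespace CrossedProduct

noncomputable instance : NonUnitalCStarAlgebra α.CrossedProduct :=
  inferInstanceAs (NonUnitalCStarAlgebra (AlgCrossedProduct.maxNorm α).Completion)

/-- The canonical *-homomorphism `A ⋊_alg G → A ⋊_α G`. -/
noncomputable def ofAlg : α.AlgCrossedProduct →⋆ₙₐ[ℂ] α.CrossedProduct :=
  CStarSeminorm.Completion.ofHom (AlgCrossedProduct.maxNorm α)

/-- The element `a δ_g` of `A ⋊_α G`, for `a ∈ A_g`. -/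
noncomputable def δ (g : G) (a : α.ideal g) : α.CrossedProduct :=
  ofAlg α (AlgCrossedProduct.δ α g a)

end CrossedProduct

/-! ### Equivariant maps and inductive limits -/

/-- A *-homomorphism `φ : A → B` is `G`-equivariant if `φ (A_g) ⊆ B_g` and
`φ ∘ α_g = β_g ∘ φ` on `A_{g⁻¹}`. -/
structure IsEquivariant {B : Type w} [NonUnitalCStarAlgebra B]
    (α : PartialAction G A) (β : PartialAction G B) (φ : A →⋆ₙₐ[ℂ] B) : Prop where
  map_mem : ∀ g, ∀ a ∈ α.ideal g, φ a ∈ β.ideal g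
  map_map : ∀ (g : G) (a : α.ideal g⁻¹), φ (α.map g a) = β.map g ⟨φ a, map_mem _ _ a.2⟩

end PartialAction

end PartialActions

section InductiveLimits

/-- `(L, μ)` is an inductive limit of the inductive sequence `(A i, φ i)` of C*-algebras : the
maps `μ i` are compatible with the `φ i`, and every other compatible family `ν i : A i → B` into
a C*-algebra `B` factors uniquely through `(L, μ)`. -/
structure IsInductiveLimit {A : ℕ → Type u} [∀ i, NonUnitalCStarAlgebra (A i)]
    (φ : ∀ i, A i →⋆ₙₐ[ℂ] A (i + 1)) {L : Type v} [NonUnitalCStarAlgebra L]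
    (μ : ∀ i, A i →⋆ₙₐ[ℂ] L) : Prop where
  comp_eq : ∀ i, (μ (i + 1)).comp (φ i) = μ i
  existsUnique : ∀ (B : Type w) [NonUnitalCStarAlgebra B] (ν : ∀ i, A i →⋆ₙₐ[ℂ] B),
    (∀ i, (ν (i + 1)).comp (φ i) = ν i) → ∃! θ : L →⋆ₙₐ[ℂ] B, ∀ i, θ.comp (μ i) = ν i

/-- `β` is the inductive limit of the partial actions `α i`, along the maps `μ i : A i → L` into
the inductive limit C*-algebra : `L_g` is the inductive limit of the ideals `(A i)_g`, i.e. the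
closure of the union of their images, and `β_g ∘ μ i = μ i ∘ (α i)_g` on `(A i)_{g⁻¹}`. -/
structure IsInductiveLimitAction {G : Type v} [Group G] {A : ℕ → Type u}
    [∀ i, NonUnitalCStarAlgebra (A i)] (α : ∀ i, PartialAction G (A i))
    {L : Type w} [NonUnitalCStarAlgebra L] (μ : ∀ i, A i →⋆ₙₐ[ℂ] L)
    (β : PartialAction G L) : Prop where
  equivariant : ∀ i, (α i).IsEquivariant β (μ i)
  ideal_eq : ∀ g, (β.ideal g : Set L) = closure (⋃ i, μ i '' ((α i).ideal g : Set (A i)))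

end InductiveLimits

/-!
Everything rests on a description of an inductive limit `(L, μ)` of C*-algebras derived from its
universal property alone: the images of the stages are dense (their closure has the universal
property too, `IsInductiveLimit.closure_iUnion_range`), and `‖μ i a‖` is the infimum of the norms of
the images of `a` in the later stages.  The latter (`IsInductiveLimit.exists_norm_connectingMap_lt`)
is seen by mapping `L` to a concrete C*-algebra, the completion of the *-algebra of eventually
compatible sequences for the C*-seminorm `x ↦ lim ‖x i‖`.

Consequently, if `I i` is a subalgebra of the `i`-th stage and the `I i` are preserved by the
connecting maps, then every compatible family of linear contractions from the `I i` to a Banach space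
extends to the closure of `⋃ i, μ i (I i)` (`exists_limit_extension`); identities between continuous
maps there need to be checked only on the `μ i (I i)` (`limit_induction`, `limit_induction₂`).

* The limit partial action consists of the extensions of `μ i ∘ α_g`.  That `β_{gh}` extends
  `β_g ∘ β_h` is checked by density on `L_h ∩ L_{g⁻¹}`; this is legitimate because the intersection
  of two limit ideals is the limit of the intersections (`inf_eq_closure`), by an approximate unit.
* A *-homomorphism out of a partial crossed product amounts to linear maps on the `A_g` respecting
  products and adjoints of homogeneous elements (`PartialAction.CrossedProduct.exists_hom`), so
  equivariant maps induce maps of crossed products.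
* A compatible family of *-homomorphisms `ν i` from the crossed products of the stages to `B`
  restricts to the compatible contractions `a ↦ ν i (a δ_g)`.  Their extensions to the `L_g` respect
  products and adjoints by density, and so define the required map on the crossed product of `L`
  (`IsInductiveLimitAction.isInductiveLimit_crossedProduct`).
-/

/-! ### The norm of an inductive limit -/

section LimitNorm

open Filter Topology

variable {A : ℕ → Type u} [∀ i, NonUnitalCStarAlgebra (A i)]
  (φ : ∀ i, A i →⋆ₙₐ[ℂ] A (i + 1))

/-- The connecting map `A i → A j` of an inductive sequence, for `i ≤ j`. -/
noncomputable def connectingMap {i j : ℕ} (h : i ≤ j) : A i →⋆ₙₐ[ℂ] A j :=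
  Nat.leRec (motive := fun j _ => A i →⋆ₙₐ[ℂ] A j) (NonUnitalStarAlgHom.id ℂ (A i))
    (fun k _ f => (φ k).comp f) h

lemma connectingMap_self (i : ℕ) (a : A i) : connectingMap φ le_rfl a = a := by
  rw [connectingMap, Nat.leRec_self]; rfl

lemma connectingMap_succ {i j : ℕ} (h : i ≤ j) (a : A i) :
    connectingMap φ (Nat.le_succ_of_le h) a = φ j (connectingMap φ h a) := by
  rw [connectingMap, Nat.leRec_succ _ _ h]; rfl

/-- Connecting maps preserve every `φ`-stable family of subsets. -/
lemma connectingMap_mem {I : ∀ i, Set (A i)} (hI : ∀ i, ∀ a ∈ I i, φ i a ∈ I (i + 1))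
    {i j : ℕ} (h : i ≤ j) {a : A i} (ha : a ∈ I i) : connectingMap φ h a ∈ I j := by
  induction j, h using Nat.le_induction with
  | base => rwa [connectingMap_self]
  | succ j h ih => rw [connectingMap_succ φ h]; exact hI j _ ih

/-- The *-algebra of the sequences `(x i)` with `x (i + 1) = φ i (x i)` for all large `i`. -/
def eventuallyCompatible : NonUnitalStarSubalgebra ℂ (∀ i, A i) where
  carrier := {x | ∀ᶠ i in atTop, x (i + 1) = φ i (x i)}
  zero_mem' := .of_forall fun i => (map_zero (φ i)).symm
  add_mem' hx hy := by
    filter_upwards [hx, hy] with i h h'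
    rw [Pi.add_apply, Pi.add_apply, map_add, h, h']
  mul_mem' hx hy := by
    filter_upwards [hx, hy] with i h h'
    rw [Pi.mul_apply, Pi.mul_apply, map_mul, h, h']
  smul_mem' c x hx := by
    filter_upwards [hx] with i h
    rw [Pi.smul_apply, Pi.smul_apply, map_smul, h]
  star_mem' hx := by
    filter_upwards [hx] with i h
    rw [Pi.star_apply, Pi.star_apply, map_star, h]

/-- The norms along an eventually compatible sequence are eventually decreasing. -/
lemma exists_tendsto_norm (x : eventuallyCompatible φ) :
    ∃ l, Tendsto (fun i => ‖x.1 i‖) atTop (𝓝 l) := by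
  obtain ⟨N, hN⟩ := eventually_atTop.mp x.2
  have hanti : Antitone fun k => ‖x.1 (k + N)‖ := antitone_nat_of_succ_le fun k => by
    rw [show k + 1 + N = k + N + 1 by omega, hN (k + N) (Nat.le_add_left N k)]
    exact NonUnitalStarAlgHom.norm_apply_le (φ (k + N)) _
  refine ⟨_, (tendsto_add_atTop_iff_nat N).mp (tendsto_atTop_ciInf hanti ⟨0, ?_⟩)⟩
  rintro _ ⟨k, rfl⟩
  exact norm_nonneg _

lemma tendsto_norm_limUnder (x : eventuallyCompatible φ) :
    Tendsto (fun i => ‖x.1 i‖) atTop (𝓝 (limUnder atTop fun i => ‖x.1 i‖)) :=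
  tendsto_nhds_limUnder (exists_tendsto_norm φ x)

/-- The C*-seminorm `x ↦ lim ‖x i‖` on eventually compatible sequences.  The completion for it
is a concrete model of the inductive limit. -/
noncomputable def limitSeminorm : CStarSeminorm (eventuallyCompatible φ) where
  toFun x := limUnder atTop fun i => ‖x.1 i‖
  map_zero' := tendsto_nhds_unique (tendsto_norm_limUnder φ 0) <|
    tendsto_const_nhds.congr fun _ => norm_zero.symm
  add_le' x y := le_of_tendsto_of_tendsto' (tendsto_norm_limUnder φ (x + y))
    ((tendsto_norm_limUnder φ x).add (tendsto_norm_limUnder φ y)) fun _ => norm_add_le _ _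
  neg' x := tendsto_nhds_unique (tendsto_norm_limUnder φ (-x)) <|
    (tendsto_norm_limUnder φ x).congr fun _ => (norm_neg _).symm
  smul' c x := tendsto_nhds_unique (tendsto_norm_limUnder φ (c • x)) <|
    ((tendsto_norm_limUnder φ x).const_mul ‖c‖).congr fun _ => (norm_smul _ _).symm
  mul_le' x y := le_of_tendsto_of_tendsto' (tendsto_norm_limUnder φ (x * y))
    ((tendsto_norm_limUnder φ x).mul (tendsto_norm_limUnder φ y)) fun _ => norm_mul_le _ _
  star_eq' x := tendsto_nhds_unique (tendsto_norm_limUnder φ (star x)) <|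
    (tendsto_norm_limUnder φ x).congr fun _ => (norm_star _).symm
  star_mul_self' x := tendsto_nhds_unique (tendsto_norm_limUnder φ (star x * x)) <|
    ((tendsto_norm_limUnder φ x).pow 2).congr fun _ => by
      rw [pow_two]; exact CStarRing.norm_star_mul_self.symm

lemma tendsto_limitSeminorm (x : eventuallyCompatible φ) :
    Tendsto (fun i => ‖x.1 i‖) atTop (𝓝 (limitSeminorm φ x)) :=
  tendsto_norm_limUnder φ x

open scoped Classical in
/-- The sequence of the images of `a ∈ A i`, extended by zero below `i`. -/
noncomputable def imageSequence (i : ℕ) : A i →⋆ₙₐ[ℂ] eventuallyCompatible φ where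
  toFun a := ⟨fun j => if h : i ≤ j then connectingMap φ h a else 0, by
    filter_upwards [eventually_ge_atTop i] with j h
    rw [dif_pos (Nat.le_succ_of_le h), dif_pos h, connectingMap_succ]⟩
  map_smul' c a := by
    ext j; by_cases h : i ≤ j <;> simp [h]
  map_zero' := by
    ext j; by_cases h : i ≤ j <;> simp [h]
  map_add' a b := by
    ext j; by_cases h : i ≤ j <;> simp [h]
  map_mul' a b := by
    ext j; by_cases h : i ≤ j <;> simp [h]
  map_star' a := by
    ext j; by_cases h : i ≤ j <;> simp [h, map_star]

lemma imageSequence_apply {i j : ℕ} (h : i ≤ j) (a : A i) :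
    (imageSequence φ i a).1 j = connectingMap φ h a := dif_pos h

lemma connectingMap_map {i j : ℕ} (h : i + 1 ≤ j) (a : A i) :
    connectingMap φ h (φ i a) = connectingMap φ ((Nat.le_succ i).trans h) a := by
  induction j, h using Nat.le_induction with
  | base => rw [connectingMap_self, connectingMap_succ φ le_rfl, connectingMap_self]
  | succ j h ih =>
    rw [connectingMap_succ φ h, ih, connectingMap_succ φ ((Nat.le_succ i).trans h)]

namespace IsInductiveLimit

variable {φ} {L : Type u} [NonUnitalCStarAlgebra L] {μ : ∀ i, A i →⋆ₙₐ[ℂ] L}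

lemma apply_connectingMap {L : Type*} [NonUnitalCStarAlgebra L] {μ : ∀ i, A i →⋆ₙₐ[ℂ] L}
    (hμ : ∀ i, (μ (i + 1)).comp (φ i) = μ i) {i j : ℕ} (h : i ≤ j) (a : A i) :
    μ j (connectingMap φ h a) = μ i a := by
  induction j, h using Nat.le_induction with
  | base => rw [connectingMap_self]
  | succ j h ih =>
    rw [connectingMap_succ, ← ih, ← hμ j]; rfl

/-- The norm in an inductive limit is the limit of the norms along the sequence; the inequality
`≥` comes from mapping the limit to the completion of the eventually compatible sequences. -/
lemma exists_norm_connectingMap_lt (hL : IsInductiveLimit.{u, u, u} φ μ) {i : ℕ} (a : A i)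
    {r : ℝ} (hr : ‖μ i a‖ < r) : ∃ (j : ℕ) (h : i ≤ j), ‖connectingMap φ h a‖ < r := by
  let ν (i : ℕ) : A i →⋆ₙₐ[ℂ] (limitSeminorm φ).Completion :=
    (CStarSeminorm.Completion.ofHom (limitSeminorm φ)).comp (imageSequence φ i)
  have hnorm (x : eventuallyCompatible φ) :
      ‖CStarSeminorm.Completion.ofHom (limitSeminorm φ) x‖ = limitSeminorm φ x :=
    CStarSeminorm.Completion.norm_ofCarrier _ x
  have hν (i : ℕ) : (ν (i + 1)).comp (φ i) = ν i := by
    ext a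
    rw [← sub_eq_zero, ← norm_eq_zero]
    change ‖CStarSeminorm.Completion.ofHom (limitSeminorm φ) (imageSequence φ (i + 1) (φ i a))
      - CStarSeminorm.Completion.ofHom (limitSeminorm φ) (imageSequence φ i a)‖ = 0
    rw [← map_sub, hnorm]
    -- the two sequences differ at the index `i` only
    refine tendsto_nhds_unique (tendsto_limitSeminorm φ _) (tendsto_const_nhds.congr' ?_)
    filter_upwards [eventually_ge_atTop (i + 1)] with j h
    change 0 = ‖(imageSequence φ (i + 1) (φ i a)).1 j - (imageSequence φ i a).1 j‖
    rw [imageSequence_apply φ h, imageSequence_apply φ ((Nat.le_succ i).trans h),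
      connectingMap_map, sub_self, norm_zero]
  obtain ⟨θ, hθ, -⟩ := hL.existsUnique _ ν hν
  have hlt : limitSeminorm φ (imageSequence φ i a) < r := by
    rw [← hnorm]
    refine lt_of_le_of_lt ?_ hr
    have := NonUnitalStarAlgHom.norm_apply_le θ (μ i a)
    rwa [show θ (μ i a) = ν i a from DFunLike.congr_fun (hθ i) a] at this
  obtain ⟨j, hj, h⟩ := (((tendsto_limitSeminorm φ (imageSequence φ i a)).eventually_lt_const
    hlt).and (eventually_ge_atTop i)).exists
  exact ⟨j, h, by rwa [imageSequence_apply φ h] at hj⟩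

end IsInductiveLimit

end LimitNorm

/-! ### Limits of subalgebras and extension of compatible families of maps -/

section LimitSubalgebra

variable {A : ℕ → Type u} [∀ i, NonUnitalCStarAlgebra (A i)]
  {φ : ∀ i, A i →⋆ₙₐ[ℂ] A (i + 1)} {L : Type v} [NonUnitalCStarAlgebra L]
  {μ : ∀ i, A i →⋆ₙₐ[ℂ] L} (hμ : ∀ i, (μ (i + 1)).comp (φ i) = μ i)
  {I J : ∀ i, NonUnitalStarSubalgebra ℂ (A i)}
  (hI : ∀ i, ∀ a ∈ I i, φ i a ∈ I (i + 1)) (hJ : ∀ i, ∀ a ∈ J i, φ i a ∈ J (i + 1))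

include hμ hI in
/-- Every element of the union is represented at all later indices. -/
lemma exists_rep_of_le {i j : ℕ} (h : i ≤ j) (a : I i) : ∃ a' : I j, μ j a' = μ i a :=
  ⟨⟨connectingMap φ h a, connectingMap_mem φ (I := fun i => (I i : Set (A i))) hI h a.2⟩,
    IsInductiveLimit.apply_connectingMap hμ h _⟩

include hμ hI hJ in
lemma exists_common_rep {i j : ℕ} (a : I i) (b : J j) :
    ∃ (k : ℕ) (a' : I k) (b' : J k), μ k a' = μ i a ∧ μ k b' = μ j b := by
  obtain ⟨a', ha⟩ := exists_rep_of_le hμ hI (le_max_left i j) a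
  obtain ⟨b', hb⟩ := exists_rep_of_le hμ hJ (le_max_right i j) b
  exact ⟨_, a', b', ha, hb⟩

/-- The union of the images `μ i (I i)` of an increasing sequence of *-subalgebras. -/
def unionImage : NonUnitalStarSubalgebra ℂ L where
  carrier := ⋃ i, μ i '' (I i : Set (A i))
  zero_mem' := Set.mem_iUnion.mpr ⟨0, 0, zero_mem _, map_zero _⟩
  add_mem' {x y} hx hy := by
    obtain ⟨i, a, ha, rfl⟩ := Set.mem_iUnion.mp hx
    obtain ⟨j, b, hb, rfl⟩ := Set.mem_iUnion.mp hy
    obtain ⟨k, a', b', h, h'⟩ := exists_common_rep hμ hI hI ⟨a, ha⟩ ⟨b, hb⟩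
    exact Set.mem_iUnion.mpr ⟨k, _, add_mem a'.2 b'.2, by rw [map_add, h, h']⟩
  mul_mem' {x y} hx hy := by
    obtain ⟨i, a, ha, rfl⟩ := Set.mem_iUnion.mp hx
    obtain ⟨j, b, hb, rfl⟩ := Set.mem_iUnion.mp hy
    obtain ⟨k, a', b', h, h'⟩ := exists_common_rep hμ hI hI ⟨a, ha⟩ ⟨b, hb⟩
    exact Set.mem_iUnion.mpr ⟨k, _, mul_mem a'.2 b'.2, by rw [map_mul, h, h']⟩
  smul_mem' c x hx := by
    obtain ⟨i, a, ha, rfl⟩ := Set.mem_iUnion.mp hx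
    exact Set.mem_iUnion.mpr ⟨i, _, SMulMemClass.smul_mem c ha, map_smul _ _ _⟩
  star_mem' {x} hx := by
    obtain ⟨i, a, ha, rfl⟩ := Set.mem_iUnion.mp hx
    exact Set.mem_iUnion.mpr ⟨i, _, star_mem ha, map_star _ _⟩

variable {K K' : NonUnitalStarSubalgebra ℂ L}
  (hK : (K : Set L) = closure (⋃ i, μ i '' (I i : Set (A i))))
  (hK' : (K' : Set L) = closure (⋃ i, μ i '' (J i : Set (A i))))

include hK in
lemma apply_mem_of_eq_closure {i : ℕ} {a : A i} (ha : a ∈ I i) : μ i a ∈ K := by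
  rw [← SetLike.mem_coe, hK]
  exact subset_closure (Set.mem_iUnion.mpr ⟨i, a, ha, rfl⟩)

lemma denseRange_of_eq_closure :
    DenseRange fun p : Σ i, I i => (⟨μ p.1 p.2, apply_mem_of_eq_closure hK p.2.2⟩ : K) := by
  intro x
  rw [closure_subtype]
  have hx : (x : L) ∈ closure (⋃ i, μ i '' (I i : Set (A i))) := hK ▸ x.2
  refine closure_mono ?_ hx
  rintro _ hy
  obtain ⟨i, a, ha, rfl⟩ := Set.mem_iUnion.mp hy
  exact ⟨⟨μ i a, apply_mem_of_eq_closure hK ha⟩, ⟨⟨i, a, ha⟩, rfl⟩, rfl⟩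

/-- A closed condition on the limit `K` of the `I i` may be checked on the images of the `I i`. -/
lemma limit_induction {P : K → Prop} (hP : IsClosed {x | P x})
    (h : ∀ (i : ℕ) (a : I i), P ⟨μ i a, apply_mem_of_eq_closure hK a.2⟩) (x : K) : P x :=
  (denseRange_of_eq_closure hK).induction_on (p := P) x hP fun p => h p.1 p.2

include hμ hI hJ in
/-- Two-variable form: the two elements may be taken from the same stage of the sequence. -/
lemma limit_induction₂ {P : K → K' → Prop} (hP : IsClosed {p : K × K' | P p.1 p.2})
    (h : ∀ (i : ℕ) (a : I i) (b : J i), P ⟨μ i a, apply_mem_of_eq_closure hK a.2⟩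
      ⟨μ i b, apply_mem_of_eq_closure hK' b.2⟩) (x : K) (y : K') : P x y := by
  have key := ((denseRange_of_eq_closure hK).prodMap (denseRange_of_eq_closure hK')).induction_on
    (p := fun p : K × K' => P p.1 p.2) (x, y) hP
  refine key ?_
  rintro ⟨⟨i, a⟩, ⟨j, b⟩⟩
  obtain ⟨k, a', b', ha, hb⟩ := exists_common_rep hμ hI hJ a b
  have hk := h k a' b'
  simp only [ha, hb] at hk
  exact hk

variable {B : Type w} [NormedAddCommGroup B] [NormedSpace ℂ B]

/-- Contractions on the stages which are compatible with the connecting maps are contractive for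
the norm of the inductive limit. -/
lemma norm_le_norm_limit {L : Type u} [NonUnitalCStarAlgebra L] {μ : ∀ i, A i →⋆ₙₐ[ℂ] L}
    (hL : IsInductiveLimit.{u, u, u} φ μ) (f : ∀ i, I i →ₗ[ℂ] B)
    (hf : ∀ i (a : I i), f (i + 1) ⟨φ i a, hI i a a.2⟩ = f i a)
    (hnorm : ∀ i (a : I i), ‖f i a‖ ≤ ‖(a : A i)‖) (i : ℕ) (a : I i) : ‖f i a‖ ≤ ‖μ i a‖ := by
  refine le_of_forall_gt_imp_ge_of_dense fun r hr => ?_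
  obtain ⟨j, h, hj⟩ := hL.exists_norm_connectingMap_lt (a : A i) hr
  have hmem {k : ℕ} (h : i ≤ k) : connectingMap φ h (a : A i) ∈ I k :=
    connectingMap_mem φ (I := fun i => (I i : Set (A i))) hI h a.2
  have hfc : f j ⟨connectingMap φ h a, hmem h⟩ = f i a := by
    clear hj
    induction j, h using Nat.le_induction with
    | base => exact congrArg (f i) (Subtype.ext (connectingMap_self φ i _))
    | succ j h ih =>
      rw [← ih]
      exact (congrArg (f (j + 1)) (Subtype.ext (connectingMap_succ φ h _))).trans
        (hf j ⟨_, hmem h⟩)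
  rw [← hfc]
  exact (hnorm j _).trans hj.le

open scoped Classical in
/-- A compatible family of linear contractions `I i → B` into a Banach space extends to the
limit of the `I i`. -/
theorem exists_limit_extension [CompleteSpace B] {L : Type u} [NonUnitalCStarAlgebra L]
    {μ : ∀ i, A i →⋆ₙₐ[ℂ] L}
    (hL : IsInductiveLimit.{u, u, u} φ μ) {K : NonUnitalStarSubalgebra ℂ L}
    (hK : (K : Set L) = closure (⋃ i, μ i '' (I i : Set (A i)))) (f : ∀ i, I i →ₗ[ℂ] B)
    (hf : ∀ i (a : I i), f (i + 1) ⟨φ i a, hI i a a.2⟩ = f i a)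
    (hnorm : ∀ i (a : I i), ‖f i a‖ ≤ ‖(a : A i)‖) :
    ∃ F : K →L[ℂ] B, ∀ i (a : I i), F ⟨μ i a, apply_mem_of_eq_closure hK a.2⟩ = f i a := by
  let m (i : ℕ) : I i →ₗ[ℂ] K :=
    { toFun := fun a => ⟨μ i a, apply_mem_of_eq_closure hK a.2⟩
      map_add' := fun a b => Subtype.ext (map_add (μ i) (a : A i) b)
      map_smul' := fun c a => Subtype.ext (map_smul (μ i) c (a : A i)) }
  -- both maps are defined on the direct sum of the `I i`; the second factors through the first
  let e : (⨁ i, I i) →ₗ[ℂ] K := DirectSum.toModule ℂ ℕ K m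
  let F : (⨁ i, I i) →ₗ[ℂ] B := DirectSum.toModule ℂ ℕ B f
  have he (i : ℕ) (a : I i) : e (DirectSum.of (fun i => I i) i a) = m i a :=
    DirectSum.toModule_lof (M := fun i => I i) (φ := m) ℂ i a
  have hF (i : ℕ) (a : I i) : F (DirectSum.of (fun i => I i) i a) = f i a :=
    DirectSum.toModule_lof (M := fun i => I i) (φ := f) ℂ i a
  have hrep (x : ⨁ i, I i) : ∃ (N : ℕ), ∀ j, N ≤ j → ∃ a : I j, e x = m j a ∧ F x = f j a := by
    induction x using DirectSum.induction_on with
    | zero => exact ⟨0, fun j _ => ⟨0, by simp only [map_zero], by simp only [map_zero]⟩⟩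
    | of i a =>
      refine ⟨i, fun j h => ?_⟩
      induction j, h using Nat.le_induction with
      | base => exact ⟨a, he i a, hF i a⟩
      | succ j h ih =>
        obtain ⟨b, hb, hb'⟩ := ih
        refine ⟨⟨φ j b, hI j b b.2⟩, hb.trans (Subtype.ext ?_), hb'.trans (hf j b).symm⟩
        exact (DFunLike.congr_fun (hL.comp_eq j) (b : A j)).symm
    | add x y hx hy =>
      obtain ⟨N, hN⟩ := hx
      obtain ⟨M, hM⟩ := hy
      refine ⟨max N M, fun j hj => ?_⟩
      obtain ⟨a, ha, ha'⟩ := hN j ((le_max_left _ _).trans hj)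
      obtain ⟨b, hb, hb'⟩ := hM j ((le_max_right _ _).trans hj)
      exact ⟨a + b, by rw [map_add, map_add, ha, hb], by rw [map_add, map_add, ha', hb']⟩
  have hbound (x : ⨁ i, I i) : ‖F x‖ ≤ 1 * ‖e x‖ := by
    obtain ⟨N, hN⟩ := hrep x
    obtain ⟨a, ha, ha'⟩ := hN N le_rfl
    rw [ha, ha', one_mul]
    exact norm_le_norm_limit hI hL f hf hnorm N a
  have hdense : DenseRange e := (denseRange_of_eq_closure hK).mono <| by
    rintro _ ⟨⟨i, a⟩, rfl⟩
    exact ⟨_, he i a⟩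
  refine ⟨F.extendOfNorm e, fun i a => ?_⟩
  have := LinearMap.extendOfNorm_eq hdense ⟨1, hbound⟩ (DirectSum.of (fun i => I i) i a)
  rwa [he, hF] at this

/-- The same for compatible families of *-homomorphisms into a C*-algebra. -/
theorem exists_limit_extension_starHom {B : Type w} [NonUnitalCStarAlgebra B]
    {L : Type u} [NonUnitalCStarAlgebra L] {μ : ∀ i, A i →⋆ₙₐ[ℂ] L}
    (hL : IsInductiveLimit.{u, u, u} φ μ) {K : NonUnitalStarSubalgebra ℂ L}
    (hK : (K : Set L) = closure (⋃ i, μ i '' (I i : Set (A i)))) (f : ∀ i, I i →⋆ₙₐ[ℂ] B)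
    (hf : ∀ i (a : I i), f (i + 1) ⟨φ i a, hI i a a.2⟩ = f i a)
    (hnorm : ∀ i (a : I i), ‖f i a‖ ≤ ‖(a : A i)‖) :
    ∃ F : K →⋆ₙₐ[ℂ] B, Continuous F ∧
      ∀ i (a : I i), F ⟨μ i a, apply_mem_of_eq_closure hK a.2⟩ = f i a := by
  obtain ⟨F, hF⟩ := exists_limit_extension hI hL hK (fun i => (f i : I i →ₗ[ℂ] B)) hf hnorm
  have hF' (i : ℕ) (a : I i) : F ⟨μ i a, apply_mem_of_eq_closure hK a.2⟩ = f i a := hF i a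
  have hmul (x y : K) : F (x * y) = F x * F y := by
    refine limit_induction₂ hL.comp_eq hI hI hK hK (P := fun x y => F (x * y) = F x * F y)
      (isClosed_eq (by fun_prop) (by fun_prop)) (fun i a b => ?_) x y
    rw [hF', hF', ← map_mul, ← hF']
    exact congrArg F (Subtype.ext (map_mul (μ i) (a : A i) b).symm)
  have hstar (x : K) : F (star x) = star (F x) := by
    refine limit_induction hK (P := fun x => F (star x) = star (F x))
      (isClosed_eq (F.continuous.comp (continuous_subtype_val.star.subtype_mk _)) (by fun_prop))
      (fun i a => ?_) x
    rw [hF', ← map_star, ← hF']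
    exact congrArg F (Subtype.ext (map_star (μ i) (a : A i)).symm)
  exact ⟨{ toFun := F
           map_smul' := map_smul F
           map_zero' := map_zero F
           map_add' := map_add F
           map_mul' := hmul
           map_star' := hstar }, F.continuous, hF'⟩

end LimitSubalgebra

namespace IsInductiveLimit

variable {A : ℕ → Type u} [∀ i, NonUnitalCStarAlgebra (A i)]
  {φ : ∀ i, A i →⋆ₙₐ[ℂ] A (i + 1)} {L : Type v} [NonUnitalCStarAlgebra L]
  {μ : ∀ i, A i →⋆ₙₐ[ℂ] L}

/-- The images of the stages are dense in an inductive limit: the closure of their union has the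
universal property as well. -/
lemma closure_iUnion_range (hL : IsInductiveLimit.{u, v, v} φ μ) :
    closure (⋃ i, Set.range (μ i)) = Set.univ := by
  let S : NonUnitalStarSubalgebra ℂ L :=
    (unionImage hL.comp_eq (I := fun _ => ⊤) fun _ _ _ => trivial).topologicalClosure
  have hS : (S : Set L) = closure (⋃ i, Set.range (μ i)) :=
    congrArg closure (Set.iUnion_congr fun i => Set.image_univ)
  have hcl : IsClosed (S : Set L) := isClosed_closure
  have hmem (i : ℕ) (a : A i) : μ i a ∈ S := by
    rw [← SetLike.mem_coe, hS]
    exact subset_closure (Set.mem_iUnion.mpr ⟨i, a, rfl⟩)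
  obtain ⟨θ, hθ, -⟩ := hL.existsUnique S
    (fun i => NonUnitalStarAlgHom.codRestrict (μ i) S (hmem i)) fun i => by
      ext a
      exact DFunLike.congr_fun (hL.comp_eq i) a
  have hid : (NonUnitalStarSubalgebraClass.subtype S).comp θ = NonUnitalStarAlgHom.id ℂ L := by
    refine (hL.existsUnique L μ hL.comp_eq).unique (fun i => ?_) fun i => rfl
    ext a
    exact congrArg Subtype.val (DFunLike.congr_fun (hθ i) a)
  refine Set.eq_univ_of_forall fun x => ?_
  rw [← hS, ← show (θ x : L) = x from DFunLike.congr_fun hid x]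
  exact (θ x).2

end IsInductiveLimit

/-! ### Limits of *-isomorphisms and intersections of ideals -/

section LimitMaps

open Filter Topology

/-- An element of a C*-algebra is a limit of products with a fixed first factor. -/
lemma mem_closure_mul_left {A : Type u} [NonUnitalCStarAlgebra A] (x : A) :
    x ∈ closure (Set.range fun y => x * y) := by
  let : PartialOrder A := CStarAlgebra.spectralOrder A
  have : StarOrderedRing A := CStarAlgebra.spectralOrderedRing A
  exact mem_closure_of_tendsto ((CStarAlgebra.increasingApproximateUnit A).tendsto_mul_left x)
    (.of_forall fun y => ⟨y, rfl⟩)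

lemma norm_starAlgEquiv_apply {A : Type u} [NonUnitalCStarAlgebra A]
    {S T : NonUnitalStarSubalgebra ℂ A} (hS : IsClosed (S : Set A)) (hT : IsClosed (T : Set A))
    (e : S ≃⋆ₐ[ℂ] T) (a : S) : ‖(e a : A)‖ = ‖(a : A)‖ :=
  haveI : IsClosed (S : Set A) := hS
  haveI : IsClosed (T : Set A) := hT
  StarAlgEquiv.norm_map e a

lemma continuous_starAlgEquiv {A : Type u} [NonUnitalCStarAlgebra A]
    {S T : NonUnitalStarSubalgebra ℂ A} (hS : IsClosed (S : Set A)) (hT : IsClosed (T : Set A))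
    (e : S ≃⋆ₐ[ℂ] T) : Continuous e :=
  haveI : IsClosed (S : Set A) := hS
  haveI : IsClosed (T : Set A) := hT
  (StarAlgEquiv.isometry e).continuous

variable {A : ℕ → Type u} [∀ i, NonUnitalCStarAlgebra (A i)]
  {φ : ∀ i, A i →⋆ₙₐ[ℂ] A (i + 1)} {L : Type u} [NonUnitalCStarAlgebra L]
  {μ : ∀ i, A i →⋆ₙₐ[ℂ] L} (hL : IsInductiveLimit.{u, u, u} φ μ)
  {I J : ∀ i, NonUnitalStarSubalgebra ℂ (A i)}
  (hI : ∀ i, ∀ a ∈ I i, φ i a ∈ I (i + 1)) (hJ : ∀ i, ∀ a ∈ J i, φ i a ∈ J (i + 1))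
  {K K' : NonUnitalStarSubalgebra ℂ L}
  (hK : (K : Set L) = closure (⋃ i, μ i '' (I i : Set (A i))))
  (hK' : (K' : Set L) = closure (⋃ i, μ i '' (J i : Set (A i))))

include hL hK in
/-- If the `I i` are left ideals then so is their limit. -/
lemma mul_mem_left_limit (h : ∀ i (a x : A i), x ∈ I i → a * x ∈ I i)
    (hI : ∀ i, ∀ a ∈ I i, φ i a ∈ I (i + 1))
    (a x : L) (hx : x ∈ K) : a * x ∈ K := by
  have ha : a ∈ closure (⋃ i, Set.range (μ i)) := by
    rw [hL.closure_iUnion_range]; trivial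
  rw [← SetLike.mem_coe, hK] at hx ⊢
  refine map_mem_closure₂ continuous_mul ha hx fun b hb y hy => ?_
  obtain ⟨i, b, rfl⟩ := Set.mem_iUnion.mp hb
  obtain ⟨j, c, hc, rfl⟩ := Set.mem_iUnion.mp hy
  obtain ⟨k, b', c', hb', hc'⟩ := exists_common_rep (I := fun _ => ⊤) hL.comp_eq
    (fun _ _ _ => trivial) hI ⟨b, trivial⟩ ⟨c, hc⟩
  exact Set.mem_iUnion.mpr ⟨k, b' * c', h k b' c' c'.2, by rw [map_mul, hb', hc']⟩

include hL hI hJ hK hK' in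
/-- The intersection of two limit ideals is the limit of the intersections: by means of an
approximate unit, an element of the intersection is a limit of products. -/
lemma inf_eq_closure (h : ∀ i (x a : A i), x ∈ I i → x * a ∈ I i)
    (h' : ∀ i (a x : A i), x ∈ J i → a * x ∈ J i) :
    ((K ⊓ K' : NonUnitalStarSubalgebra ℂ L) : Set L)
      = closure (⋃ i, μ i '' ((I i ⊓ J i : NonUnitalStarSubalgebra ℂ (A i)) : Set (A i))) := by
  have hcl : IsClosed (K : Set L) := hK ▸ isClosed_closure
  have hcl' : IsClosed (K' : Set L) := hK' ▸ isClosed_closure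
  have hclosed : IsClosed ((K ⊓ K' : NonUnitalStarSubalgebra ℂ L) : Set L) := hcl.inter hcl'
  refine Set.Subset.antisymm (fun x hx => ?_) (closure_minimal ?_ hclosed)
  · have hx1 := map_mem_closure continuous_subtype_val
      (mem_closure_mul_left (⟨x, hx⟩ : (K ⊓ K' : NonUnitalStarSubalgebra ℂ L)))
      (t := closure (⋃ i, μ i '' ((I i ⊓ J i : NonUnitalStarSubalgebra ℂ (A i)) : Set (A i)))) ?_
    · rwa [closure_closure] at hx1
    rintro _ ⟨y, rfl⟩
    have hxK : x ∈ closure (⋃ i, μ i '' (I i : Set (A i))) := hK ▸ hx.1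
    have hyK : (y : L) ∈ closure (⋃ i, μ i '' (J i : Set (A i))) := hK' ▸ y.2.2
    refine map_mem_closure₂ continuous_mul hxK hyK fun b hb c hc => ?_
    obtain ⟨i, b₀, hb₀, rfl⟩ := Set.mem_iUnion.mp hb
    obtain ⟨j, c₀, hc₀, rfl⟩ := Set.mem_iUnion.mp hc
    obtain ⟨k, b', c', hb', hc'⟩ := exists_common_rep hL.comp_eq hI hJ ⟨b₀, hb₀⟩ ⟨c₀, hc₀⟩
    exact Set.mem_iUnion.mpr ⟨k, b' * c', ⟨h k _ _ b'.2, h' k _ _ c'.2⟩,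
      (map_mul (μ k) (b' : A k) c').trans (congrArg₂ _ hb' hc')⟩
  · refine Set.iUnion_subset fun i => ?_
    rintro _ ⟨a, ha, rfl⟩
    exact ⟨apply_mem_of_eq_closure hK ha.1, apply_mem_of_eq_closure hK' ha.2⟩

include hL hI in
/-- A compatible family of contractive *-homomorphisms `I i → J i` induces one between the
limits. -/
lemma exists_limit_starHom (e : ∀ i, I i →⋆ₙₐ[ℂ] J i)
    (he : ∀ i (a : I i), (e (i + 1) ⟨φ i a, hI i a a.2⟩ : A (i + 1)) = φ i (e i a))
    (hnorm : ∀ i (a : I i), ‖(e i a : A i)‖ ≤ ‖(a : A i)‖) :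
    ∃ F : K →⋆ₙₐ[ℂ] K', Continuous F ∧
      ∀ i (a : I i), F ⟨μ i a, apply_mem_of_eq_closure hK a.2⟩
        = ⟨μ i (e i a), apply_mem_of_eq_closure hK' (e i a).2⟩ := by
  have hcl' : IsClosed (K' : Set L) := hK' ▸ isClosed_closure
  obtain ⟨F, hFc, hF⟩ := exists_limit_extension_starHom hI hL hK
    (fun i => (μ i).comp ((NonUnitalStarSubalgebraClass.subtype (J i)).comp (e i)))
    (fun i a => by
      change μ (i + 1) (e (i + 1) _) = μ i (e i a)
      rw [he, ← hL.comp_eq i]; rfl)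
    (fun i a => (NonUnitalStarAlgHom.norm_apply_le (μ i) _).trans (hnorm i a))
  have hmem (x : K) : F x ∈ K' :=
    limit_induction hK (P := fun x => F x ∈ K') (hcl'.preimage hFc)
      (fun i a => by rw [hF]; exact apply_mem_of_eq_closure hK' (e i a).2) x
  exact ⟨NonUnitalStarAlgHom.codRestrict F K' hmem, hFc.subtype_mk _,
    fun i a => Subtype.ext (hF i a)⟩

include hL hI hJ in
/-- A compatible family of *-isomorphisms `I i ≃ J i` induces one between the limits. -/
lemma exists_limit_starEquiv (hIc : ∀ i, IsClosed (I i : Set (A i)))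
    (hJc : ∀ i, IsClosed (J i : Set (A i))) (e : ∀ i, I i ≃⋆ₐ[ℂ] J i)
    (he : ∀ i (a : I i), (e (i + 1) ⟨φ i a, hI i a a.2⟩ : A (i + 1)) = φ i (e i a)) :
    ∃ E : K ≃⋆ₐ[ℂ] K', ∀ i (a : I i), E ⟨μ i a, apply_mem_of_eq_closure hK a.2⟩
        = ⟨μ i (e i a), apply_mem_of_eq_closure hK' (e i a).2⟩ := by
  have he' (i : ℕ) (b : J i) :
      ((e (i + 1)).symm ⟨φ i b, hJ i b b.2⟩ : A (i + 1)) = φ i ((e i).symm b) := by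
    have h : e (i + 1) ⟨φ i ((e i).symm b), hI i _ ((e i).symm b).2⟩ = ⟨φ i b, hJ i b b.2⟩ :=
      Subtype.ext (by rw [he, StarAlgEquiv.apply_symm_apply])
    rw [← h, StarAlgEquiv.symm_apply_apply]
  obtain ⟨F, hFc, hF⟩ := exists_limit_starHom hL hI hK hK' (fun i => (e i).toNonUnitalStarAlgHom)
    he fun i a => (norm_starAlgEquiv_apply (hIc i) (hJc i) (e i) a).le
  obtain ⟨F', hFc', hF'⟩ := exists_limit_starHom hL hJ hK' hK
    (fun i => (e i).symm.toNonUnitalStarAlgHom)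
    he' fun i a => (norm_starAlgEquiv_apply (hJc i) (hIc i) (e i).symm a).le
  have h1 (x : K) : F' (F x) = x :=
    limit_induction hK (P := fun x => F' (F x) = x)
      (isClosed_eq (hFc'.comp hFc) continuous_id) (fun i a => by
        rw [hF, hF' i ((e i).toNonUnitalStarAlgHom a)]
        exact Subtype.ext (congrArg (fun z : I i => μ i z) ((e i).symm_apply_apply a))) x
  have h2 (x : K') : F (F' x) = x :=
    limit_induction hK' (P := fun x => F (F' x) = x)
      (isClosed_eq (hFc.comp hFc') continuous_id) (fun i a => by
        rw [hF', hF i ((e i).symm.toNonUnitalStarAlgHom a)]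
        exact Subtype.ext (congrArg (fun z : J i => μ i z) ((e i).apply_symm_apply a))) x
  exact ⟨StarAlgEquiv.ofNonUnitalStarAlgHom F F' (NonUnitalStarAlgHom.ext h1)
    (NonUnitalStarAlgHom.ext h2), hF⟩

end LimitMaps

/-! ### The inductive limit partial action -/

namespace PartialAction

variable {G : Type v} [Group G]

section

variable {A : Type u} [NonUnitalCStarAlgebra A] (α : PartialAction G A)

lemma continuous_map (g : G) : Continuous (α.map g) :=
  continuous_starAlgEquiv (α.isClosed_ideal _) (α.isClosed_ideal _) _

lemma continuous_map_symm (g : G) : Continuous (α.map g).symm :=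
  continuous_starAlgEquiv (α.isClosed_ideal _) (α.isClosed_ideal _) _

variable {α} in
/-- A partial action is determined by its ideals and the values of its maps. -/
lemma eq_of_ideal_eq {β : PartialAction G A} (h : α.ideal = β.ideal)
    (hm : ∀ g x hx hx', (α.map g ⟨x, hx⟩ : A) = β.map g ⟨x, hx'⟩) : α = β := by
  obtain ⟨I, _, _, _, m, _, _, _⟩ := α
  obtain ⟨I', _, _, _, m', _, _, _⟩ := β
  obtain rfl : I = I' := h
  obtain rfl : m = m' := by
    funext g
    exact StarAlgEquiv.ext fun x => Subtype.ext (hm g x x.2 x.2)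
  rfl

end

variable {A : ℕ → Type u} [∀ i, NonUnitalCStarAlgebra (A i)] {α : ∀ i, PartialAction G (A i)}
  {φ : ∀ i, A i →⋆ₙₐ[ℂ] A (i + 1)} (hφ : ∀ i, (α i).IsEquivariant (α (i + 1)) (φ i))
  {L : Type u} [NonUnitalCStarAlgebra L] {μ : ∀ i, A i →⋆ₙₐ[ℂ] L}

include hφ in
/-- The limits of the *-isomorphisms `(α i)_g` form a partial action on the inductive limit. -/
theorem exists_isInductiveLimitAction (hL : IsInductiveLimit.{u, u, u} φ μ) :
    ∃ β : PartialAction G L, IsInductiveLimitAction α μ β := by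
  have hI (g : G) : ∀ i, ∀ a ∈ (α i).ideal g, φ i a ∈ (α (i + 1)).ideal g :=
    fun i => (hφ i).map_mem g
  let K (g : G) : NonUnitalStarSubalgebra ℂ L := (unionImage hL.comp_eq (hI g)).topologicalClosure
  have hK (g : G) : (K g : Set L) = closure (⋃ i, μ i '' ((α i).ideal g : Set (A i))) := rfl
  have hKc (g : G) : IsClosed (K g : Set L) := isClosed_closure
  have hmem {g : G} {i : ℕ} {a : A i} (ha : a ∈ (α i).ideal g) : μ i a ∈ K g :=
    apply_mem_of_eq_closure (hK g) ha
  have hleft (g : G) (a x : L) (hx : x ∈ K g) : a * x ∈ K g :=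
    mul_mem_left_limit hL (hK g) (fun i => (α i).mul_mem_left g) (hI g) a x hx
  have hright (g : G) (x a : L) (hx : x ∈ K g) : x * a ∈ K g := by
    have := star_mem (hleft g (star a) (star x) (star_mem hx))
    rwa [star_mul, star_star, star_star] at this
  choose E hE using fun g => exists_limit_starEquiv hL (hI g⁻¹) (hI g) (hK g⁻¹) (hK g)
    (fun i => (α i).isClosed_ideal g⁻¹) (fun i => (α i).isClosed_ideal g) (fun i => (α i).map g)
    fun i a => ((hφ i).map_map g a).symm
  have hEc (g : G) : Continuous (E g) := continuous_starAlgEquiv (hKc _) (hKc _) _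
  have hEsc (g : G) : Continuous (E g).symm := continuous_starAlgEquiv (hKc _) (hKc _) _
  have hEs (g : G) (i : ℕ) (b : (α i).ideal g) :
      (E g).symm ⟨μ i b, hmem b.2⟩ = ⟨μ i (((α i).map g).symm b), hmem (Subtype.prop _)⟩ := by
    rw [StarAlgEquiv.symm_apply_eq, hE]
    simp only [StarAlgEquiv.apply_symm_apply]
  have hone : K 1 = ⊤ := SetLike.coe_injective <| by
    rw [hK]
    refine Eq.trans ?_ hL.closure_iUnion_range
    refine congrArg closure (Set.iUnion_congr fun i => ?_)
    rw [(α i).ideal_one]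
    exact Set.image_univ
  -- the domain of `β_g ∘ β_h` is the image of `K h ⊓ K g⁻¹` under the inverse of `β_h`
  have hcomp (g h : G) (y : (K h ⊓ K g⁻¹ : NonUnitalStarSubalgebra ℂ L)) :
      ∃ hy : ((E h).symm ⟨y, y.2.1⟩ : L) ∈ K (g * h)⁻¹,
        (E (g * h) ⟨(E h).symm ⟨y, y.2.1⟩, hy⟩ : L) = E g ⟨y, y.2.2⟩ := by
    have hW := inf_eq_closure hL (hI h) (hI g⁻¹) (hK h) (hK g⁻¹)
      (fun i => (α i).mul_mem_right h) (fun i => (α i).mul_mem_left g⁻¹)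
    have hi {i : ℕ} (c : ((α i).ideal h ⊓ (α i).ideal g⁻¹ : NonUnitalStarSubalgebra ℂ (A i))) :
        ∃ hc : (((α i).map h).symm ⟨c, c.2.1⟩ : A i) ∈ (α i).ideal (g * h)⁻¹,
          ((α i).map (g * h) ⟨((α i).map h).symm ⟨c, c.2.1⟩, hc⟩ : A i)
            = (α i).map g ⟨c, c.2.2⟩ := by
      have e : ((α i).map h (((α i).map h).symm ⟨c, c.2.1⟩) : A i) = c := by
        rw [StarAlgEquiv.apply_symm_apply]
      obtain ⟨hc, hc'⟩ := (α i).map_comp g h (((α i).map h).symm ⟨c, c.2.1⟩) (by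
        rw [e]; exact c.2.2)
      exact ⟨hc, hc'.trans ((α i).map_congr rfl _ _ e)⟩
    have hcont : Continuous fun y : (K h ⊓ K g⁻¹ : NonUnitalStarSubalgebra ℂ L) =>
        ((E h).symm ⟨y, y.2.1⟩ : L) :=
      continuous_subtype_val.comp ((hEsc h).comp (continuous_subtype_val.subtype_mk _))
    have hm (y : (K h ⊓ K g⁻¹ : NonUnitalStarSubalgebra ℂ L)) :
        ((E h).symm ⟨y, y.2.1⟩ : L) ∈ K (g * h)⁻¹ := by
      refine limit_induction hW (P := fun y => ((E h).symm ⟨y, y.2.1⟩ : L) ∈ K (g * h)⁻¹)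
        ((hKc _).preimage hcont) (fun i c => ?_) y
      rw [hEs h i ⟨c, c.2.1⟩]
      exact hmem (hi c).1
    refine ⟨hm y, ?_⟩
    refine limit_induction hW
      (P := fun y => (E (g * h) ⟨(E h).symm ⟨y, y.2.1⟩, hm y⟩ : L) = E g ⟨y, y.2.2⟩)
      (isClosed_eq (continuous_subtype_val.comp ((hEc _).comp (hcont.subtype_mk _)))
        (continuous_subtype_val.comp ((hEc _).comp (continuous_subtype_val.subtype_mk _))))
      (fun i c => ?_) y
    obtain ⟨hc, hc'⟩ := hi c
    have e₀ := congrArg Subtype.val (hEs h i ⟨c, c.2.1⟩)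
    have e : (⟨_, hm ⟨μ i c, apply_mem_of_eq_closure hW c.2⟩⟩ : K (g * h)⁻¹)
        = ⟨μ i (((α i).map h).symm ⟨c, c.2.1⟩), hmem hc⟩ :=
      Subtype.ext e₀
    rw [e, hE (g * h) i ⟨_, hc⟩, hE g i ⟨c, c.2.2⟩]
    exact congrArg (μ i) hc'
  refine ⟨{ ideal := K
            isClosed_ideal := hKc
            mul_mem_left := hleft
            mul_mem_right := hright
            map := E
            ideal_one := hone
            map_one := fun x => ?_
            map_comp := fun g h x hx => ?_ }, ⟨fun i => ⟨fun g a ha => hmem ha, fun g a => ?_⟩, hK⟩⟩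
  · refine limit_induction (hK 1⁻¹) (P := fun x => (E 1 x : L) = x)
      (isClosed_eq (continuous_subtype_val.comp (hEc 1)) continuous_subtype_val)
      (fun i a => ?_) x
    rw [hE]
    exact congrArg (μ i) ((α i).map_one a)
  · have e : (E h).symm ⟨E h x, (E h x).2⟩ = x := (E h).symm_apply_apply x
    obtain ⟨hy, hy'⟩ := hcomp g h ⟨E h x, (E h x).2, hx⟩
    simp only [e] at hy hy'
    exact ⟨hy, hy'⟩
  · exact (congrArg Subtype.val (hE g i a)).symm

theorem existsUnique_isInductiveLimitAction (hL : IsInductiveLimit.{u, u, u} φ μ)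
    (hφ : ∀ i, (α i).IsEquivariant (α (i + 1)) (φ i)) :
    ∃! β : PartialAction G L, IsInductiveLimitAction α μ β := by
  obtain ⟨β, hβ⟩ := exists_isInductiveLimitAction hφ hL
  refine ⟨β, hβ, fun β' hβ' => ?_⟩
  have hid : β'.ideal = β.ideal := funext fun g => SetLike.coe_injective <| by
    rw [hβ'.ideal_eq, hβ.ideal_eq]
  refine eq_of_ideal_eq hid fun g x hx hx' => ?_
  have hsub (y : β.ideal g⁻¹) : (y : L) ∈ β'.ideal g⁻¹ := by rw [hid]; exact y.2
  refine limit_induction (hβ.ideal_eq g⁻¹)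
    (P := fun x => (β'.map g ⟨x, hsub x⟩ : L) = β.map g x)
    (isClosed_eq (continuous_subtype_val.comp ((β'.continuous_map g).comp
      (continuous_subtype_val.subtype_mk _))) (continuous_subtype_val.comp (β.continuous_map g)))
    (fun i a => ?_) ⟨x, hx'⟩
  exact ((hβ'.equivariant i).map_map g a).symm.trans ((hβ.equivariant i).map_map g a)

end PartialAction

/-! ### Maps out of partial crossed products -/

namespace PartialAction

variable {G : Type v} [Group G]

namespace CrossedProduct

variable {A : Type u} [NonUnitalCStarAlgebra A] (α : PartialAction G A)

lemma norm_ofAlg (x : α.AlgCrossedProduct) : ‖ofAlg α x‖ = AlgCrossedProduct.maxNorm α x :=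
  CStarSeminorm.Completion.norm_ofCarrier (AlgCrossedProduct.maxNorm α) x

lemma denseRange_ofAlg : DenseRange (ofAlg α) :=
  CStarSeminorm.Completion.denseRange_ofCarrier (AlgCrossedProduct.maxNorm α)

lemma seminorm_le_norm_ofAlg (p : CStarSeminorm α.AlgCrossedProduct) (x : α.AlgCrossedProduct) :
    p x ≤ ‖ofAlg α x‖ := by
  rw [norm_ofAlg]
  exact le_ciSup (AlgCrossedProduct.bddAbove_seminorms α x) p

lemma norm_δ_le (g : G) (a : α.ideal g) : ‖δ α g a‖ ≤ ‖(a : A)‖ := by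
  rw [δ, norm_ofAlg]
  exact ciSup_le fun p => AlgCrossedProduct.seminorm_δ_le α p g a

/-- The map `a ↦ a δ_g`, as a linear map. -/
noncomputable def linδ (g : G) : α.ideal g →ₗ[ℂ] α.CrossedProduct :=
  (ofAlg α : α.AlgCrossedProduct →ₗ[ℂ] α.CrossedProduct) ∘ₗ AlgCrossedProduct.δ α g

lemma continuous_δ (g : G) : Continuous (δ α g) :=
  AddMonoidHomClass.continuous_of_bound (linδ α g) 1 fun a => by
    rw [one_mul]; exact norm_δ_le α g a

lemma δ_mul_δ (g h : G) (a : α.ideal g) (b : α.ideal h) :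
    δ α g a * δ α h b = δ α (g * h) (α.mulAux g h a b) := by
  rw [δ, δ, ← map_mul, AlgCrossedProduct.δ_mul_δ]; rfl

lemma star_δ (g : G) (a : α.ideal g) : star (δ α g a) = δ α g⁻¹ (α.starAux g a) := by
  rw [δ, ← map_star, AlgCrossedProduct.star_δ]; rfl

variable {α} {B : Type w} [NonUnitalCStarAlgebra B]

open scoped CStarAlgebra in
lemma hom_ext {F F' : α.CrossedProduct →⋆ₙₐ[ℂ] B} (h : ∀ g a, F (δ α g a) = F' (δ α g a)) :
    F = F' := by
  refine DFunLike.coe_injective ((denseRange_ofAlg α).equalizer (map_continuous F)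
    (map_continuous F') (funext fun x => ?_))
  induction x using AlgCrossedProduct.ind with
  | h0 => simp only [Function.comp_apply, map_zero]
  | hδ g a => exact h g a
  | hadd x y hx hy =>
    simp only [Function.comp_apply, map_add] at hx hy ⊢
    rw [hx, hy]

variable (α) in
/-- The universal property of the partial crossed product: linear maps on the `A_g` which respect
the product and the adjoint of homogeneous elements come from a *-homomorphism.  The norm of its
values is a C*-seminorm on the algebraic crossed product, hence dominated by `‖·‖_max`. -/
theorem exists_hom (f : ∀ g, α.ideal g →ₗ[ℂ] B)
    (hmul : ∀ g h a b, f g a * f h b = f (g * h) (α.mulAux g h a b))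
    (hstar : ∀ g a, star (f g a) = f g⁻¹ (α.starAux g a)) :
    ∃ F : α.CrossedProduct →⋆ₙₐ[ℂ] B, ∀ g a, F (δ α g a) = f g a := by
  let Θ : α.AlgCrossedProduct →ₗ[ℂ] B := AlgCrossedProduct.lift α f
  have hΘ (g : G) (a : α.ideal g) : Θ (AlgCrossedProduct.δ α g a) = f g a :=
    AlgCrossedProduct.lift_δ α f g a
  have hΘmul (x y : α.AlgCrossedProduct) : Θ (x * y) = Θ x * Θ y := by
    induction x using AlgCrossedProduct.ind with
    | h0 => simp only [zero_mul, map_zero]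
    | hadd x x' hx hx' => simp only [add_mul, map_add, hx, hx']
    | hδ g a =>
      induction y using AlgCrossedProduct.ind with
      | h0 => simp only [mul_zero, map_zero]
      | hadd y y' hy hy' => simp only [mul_add, map_add, hy, hy']
      | hδ h b => rw [AlgCrossedProduct.δ_mul_δ, hΘ, hΘ, hΘ, hmul]
  have hΘstar (x : α.AlgCrossedProduct) : Θ (star x) = star (Θ x) := by
    induction x using AlgCrossedProduct.ind with
    | h0 => simp only [star_zero, map_zero]
    | hadd x x' hx hx' => simp only [star_add, map_add, hx, hx']
    | hδ g a => rw [AlgCrossedProduct.star_δ, hΘ, hΘ, hstar]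
  let p : CStarSeminorm α.AlgCrossedProduct :=
    { toFun := fun x => ‖Θ x‖
      map_zero' := by rw [map_zero, norm_zero]
      add_le' := fun x y => by rw [map_add]; exact norm_add_le _ _
      neg' := fun x => by rw [map_neg, norm_neg]
      smul' := fun c x => by rw [map_smul, norm_smul]
      mul_le' := fun x y => by rw [hΘmul]; exact norm_mul_le _ _
      star_eq' := fun x => by rw [hΘstar, norm_star]
      star_mul_self' := fun x => by
        rw [hΘmul, hΘstar, CStarRing.norm_star_mul_self, pow_two] }
  let e : α.AlgCrossedProduct →ₗ[ℂ] α.CrossedProduct := ofAlg α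
  have hd : DenseRange e := denseRange_ofAlg α
  let F : α.CrossedProduct →L[ℂ] B := Θ.extendOfNorm e
  have hF (x : α.AlgCrossedProduct) : F (ofAlg α x) = Θ x :=
    LinearMap.extendOfNorm_eq hd
      ⟨1, fun x => by rw [one_mul]; exact seminorm_le_norm_ofAlg α p x⟩ x
  have hFmul (x y : α.CrossedProduct) : F (x * y) = F x * F y := by
    refine (denseRange_ofAlg α).induction_on₂ (p := fun x y => F (x * y) = F x * F y)
      (isClosed_eq (by fun_prop) (by fun_prop)) (fun a b => ?_) x y
    rw [← map_mul, hF, hF, hF, hΘmul]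
  have hFstar (x : α.CrossedProduct) : F (star x) = star (F x) := by
    refine (denseRange_ofAlg α).induction_on (p := fun x => F (star x) = star (F x)) x
      (isClosed_eq (F.continuous.comp continuous_star) (by fun_prop)) (fun a => ?_)
    rw [← map_star, hF, hF, hΘstar]
  exact ⟨{ toFun := F
           map_smul' := map_smul F
           map_zero' := map_zero F
           map_add' := map_add F
           map_mul' := hFmul
           map_star' := hFstar }, fun g a => (hF _).trans (hΘ g a)⟩

end CrossedProduct

lemma continuous_mulAux {A : Type u} [NonUnitalCStarAlgebra A] (α : PartialAction G A) (g h : G) :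
    Continuous fun p : α.ideal g × α.ideal h => α.mulAux g h p.1 p.2 := by
  have h1 : Continuous fun p : α.ideal g × α.ideal h => ((α.map g).symm p.1 : A) * p.2 :=
    (continuous_subtype_val.comp ((α.continuous_map_symm g).comp continuous_fst)).mul
      (continuous_subtype_val.comp continuous_snd)
  exact (continuous_subtype_val.comp ((α.continuous_map g).comp (h1.subtype_mk _))).subtype_mk _

lemma continuous_starAux {A : Type u} [NonUnitalCStarAlgebra A] (α : PartialAction G A) (g : G) :
    Continuous (α.starAux g) :=
  (α.continuous_map_symm g).comp (continuous_subtype_val.star.subtype_mk _)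

namespace IsEquivariant

variable {A : Type u} [NonUnitalCStarAlgebra A] {α : PartialAction G A}
  {B : Type w} [NonUnitalCStarAlgebra B] {β : PartialAction G B} {φ : A →⋆ₙₐ[ℂ] B}
  (hφ : α.IsEquivariant β φ)

lemma map_symm (g : G) (a : α.ideal g) :
    φ ((α.map g).symm a) = (β.map g).symm ⟨φ a, hφ.map_mem g a a.2⟩ := by
  have h : β.map g ⟨φ ((α.map g).symm a), hφ.map_mem _ _ (Subtype.prop _)⟩
      = ⟨φ a, hφ.map_mem g a a.2⟩ :=
    Subtype.ext (by rw [← hφ.map_map, StarAlgEquiv.apply_symm_apply])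
  rw [← h, StarAlgEquiv.symm_apply_apply]

lemma map_mulAux (g h : G) (a : α.ideal g) (b : α.ideal h) :
    φ (α.mulAux g h a b)
      = β.mulAux g h ⟨φ a, hφ.map_mem g a a.2⟩ ⟨φ b, hφ.map_mem h b b.2⟩ :=
  (hφ.map_map g _).trans <| β.map_congr rfl _ _ <| by rw [map_mul, hφ.map_symm]

lemma map_starAux (g : G) (a : α.ideal g) :
    φ (α.starAux g a) = β.starAux g ⟨φ a, hφ.map_mem g a a.2⟩ :=
  (hφ.map_symm g (star a)).trans <|
    congrArg (fun z : β.ideal g => ((β.map g).symm z : B)) (Subtype.ext (map_star φ (a : A)))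

/-- An equivariant *-homomorphism induces a *-homomorphism of the partial crossed products. -/
theorem exists_crossedProduct_hom : ∃ ψ : α.CrossedProduct →⋆ₙₐ[ℂ] β.CrossedProduct,
    ∀ g (a : α.ideal g), ψ (CrossedProduct.δ α g a)
      = CrossedProduct.δ β g ⟨φ a, hφ.map_mem g a a.2⟩ := by
  let m (g : G) : α.ideal g →ₗ[ℂ] β.ideal g :=
    { toFun := fun a => ⟨φ a, hφ.map_mem g a a.2⟩
      map_add' := fun a b => Subtype.ext (map_add φ (a : A) b)
      map_smul' := fun c a => Subtype.ext (map_smul φ c (a : A)) }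
  refine CrossedProduct.exists_hom α (fun g => CrossedProduct.linδ β g ∘ₗ m g)
    (fun g h a b => ?_) fun g a => ?_
  · refine (CrossedProduct.δ_mul_δ β g h (m g a) (m h b)).trans ?_
    exact congrArg (CrossedProduct.δ β (g * h)) (Subtype.ext (hφ.map_mulAux g h a b).symm)
  · refine (CrossedProduct.star_δ β g (m g a)).trans ?_
    exact congrArg (CrossedProduct.δ β g⁻¹) (Subtype.ext (hφ.map_starAux g a).symm)

end IsEquivariant

end PartialAction

/-! ### The crossed product of the limit is the limit of the crossed products -/

namespace IsInductiveLimitAction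

variable {G : Type v} [Group G] {A : ℕ → Type u} [∀ i, NonUnitalCStarAlgebra (A i)]
  {α : ∀ i, PartialAction G (A i)} {φ : ∀ i, A i →⋆ₙₐ[ℂ] A (i + 1)}
  {L : Type u} [NonUnitalCStarAlgebra L] {μ : ∀ i, A i →⋆ₙₐ[ℂ] L} {β : PartialAction G L}

open PartialAction

open scoped CStarAlgebra in
/-- A compatible family of *-homomorphisms out of the `A i ⋊ G` is contractive on each `A_g δ_g`,
so it extends to the summands of the crossed product of the limit; the extensions respect
products and adjoints by density. -/
theorem isInductiveLimit_crossedProduct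
    (hβ : IsInductiveLimitAction α μ β) (hL : IsInductiveLimit.{u, u, u} φ μ)
    (hφ : ∀ i, (α i).IsEquivariant (α (i + 1)) (φ i))
    {ψ : ∀ i, (α i).CrossedProduct →⋆ₙₐ[ℂ] (α (i + 1)).CrossedProduct}
    {lam : ∀ i, (α i).CrossedProduct →⋆ₙₐ[ℂ] β.CrossedProduct}
    (hψ : ∀ i g (a : (α i).ideal g), ψ i (CrossedProduct.δ (α i) g a)
      = CrossedProduct.δ (α (i + 1)) g ⟨φ i a, (hφ i).map_mem g a a.2⟩)
    (hlam : ∀ i g (a : (α i).ideal g), lam i (CrossedProduct.δ (α i) g a)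
      = CrossedProduct.δ β g ⟨μ i a, (hβ.equivariant i).map_mem g a a.2⟩) :
    IsInductiveLimit.{max u v, max u v, w} ψ lam where
  comp_eq i := CrossedProduct.hom_ext fun g a => by
    rw [NonUnitalStarAlgHom.comp_apply, hψ, hlam, hlam]
    exact congrArg (CrossedProduct.δ β g)
      (Subtype.ext (DFunLike.congr_fun (hL.comp_eq i) (a : A i)))
  existsUnique B _ ν hν := by
    have hI (g : G) : ∀ i, ∀ a ∈ (α i).ideal g, φ i a ∈ (α (i + 1)).ideal g :=
      fun i => (hφ i).map_mem g
    have hK := hβ.ideal_eq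
    choose F hF using fun g => exists_limit_extension (hI g) hL (hK g)
      (fun i => (ν i : (α i).CrossedProduct →ₗ[ℂ] B) ∘ₗ CrossedProduct.linδ (α i) g)
      (fun i a => by
        change ν (i + 1) (CrossedProduct.δ (α (i + 1)) g _) = ν i (CrossedProduct.δ (α i) g a)
        rw [← hψ, ← hν i]; rfl)
      (fun i a => (NonUnitalStarAlgHom.norm_apply_le (ν i) _).trans
        (CrossedProduct.norm_δ_le (α i) g a))
    have hF' (g : G) (i : ℕ) (a : (α i).ideal g) :
        F g ⟨μ i a, (hβ.equivariant i).map_mem g a a.2⟩ = ν i (CrossedProduct.δ (α i) g a) :=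
      hF g i a
    have hmul (g h : G) (a : β.ideal g) (b : β.ideal h) :
        F g a * F h b = F (g * h) (β.mulAux g h a b) := by
      refine limit_induction₂ hL.comp_eq (hI g) (hI h) (hK g) (hK h)
        (P := fun a b => F g a * F h b = F (g * h) (β.mulAux g h a b))
        (isClosed_eq (by fun_prop) ((F (g * h)).continuous.comp (β.continuous_mulAux g h)))
        (fun i a b => ?_) a b
      rw [hF', hF', ← map_mul, CrossedProduct.δ_mul_δ, ← hF']
      exact congrArg (F (g * h)) (Subtype.ext ((hβ.equivariant i).map_mulAux g h a b))
    have hstar (g : G) (a : β.ideal g) : star (F g a) = F g⁻¹ (β.starAux g a) := by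
      refine limit_induction (hK g) (P := fun a => star (F g a) = F g⁻¹ (β.starAux g a))
        (isClosed_eq (by fun_prop) ((F g⁻¹).continuous.comp (β.continuous_starAux g)))
        (fun i a => ?_) a
      rw [hF', ← map_star, CrossedProduct.star_δ, ← hF']
      exact congrArg (F g⁻¹) (Subtype.ext ((hβ.equivariant i).map_starAux g a))
    obtain ⟨θ, hθ⟩ := CrossedProduct.exists_hom β
      (fun g => (F g : β.ideal g →ₗ[ℂ] B)) hmul hstar
    refine ⟨θ, fun i => CrossedProduct.hom_ext fun g a => ?_, fun θ' hθ' => ?_⟩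
    · rw [NonUnitalStarAlgHom.comp_apply, hlam, hθ]
      exact hF' g i a
    · refine CrossedProduct.hom_ext fun g a => ?_
      refine limit_induction (hK g)
        (P := fun a => θ' (CrossedProduct.δ β g a) = θ (CrossedProduct.δ β g a))
        (isClosed_eq ((map_continuous θ').comp (CrossedProduct.continuous_δ β g))
          ((map_continuous θ).comp (CrossedProduct.continuous_δ β g))) (fun i a => ?_) a
      rw [hθ, ← hlam, ← NonUnitalStarAlgHom.comp_apply, hθ']
      exact (hF' g i a).symm

end IsInductiveLimitAction

/-- Two inductive limits of the same sequence are canonically isomorphic. -/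
theorem IsInductiveLimit.existsUnique_starAlgEquiv {A : ℕ → Type u}
    [∀ i, NonUnitalCStarAlgebra (A i)] {φ : ∀ i, A i →⋆ₙₐ[ℂ] A (i + 1)}
    {L M : Type v} [NonUnitalCStarAlgebra L] [NonUnitalCStarAlgebra M]
    {μ : ∀ i, A i →⋆ₙₐ[ℂ] L} {ν : ∀ i, A i →⋆ₙₐ[ℂ] M}
    (hL : IsInductiveLimit.{u, v, v} φ μ) (hM : IsInductiveLimit.{u, v, v} φ ν) :
    ∃! θ : L ≃⋆ₐ[ℂ] M, ∀ i x, θ (μ i x) = ν i x := by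
  obtain ⟨θ, hθ, hu⟩ := hL.existsUnique M ν hM.comp_eq
  obtain ⟨θ', hθ', -⟩ := hM.existsUnique L μ hL.comp_eq
  have h1 : θ'.comp θ = NonUnitalStarAlgHom.id ℂ L :=
    (hL.existsUnique L μ hL.comp_eq).unique
      (fun i => by rw [NonUnitalStarAlgHom.comp_assoc, hθ, hθ']) fun i => rfl
  have h2 : θ.comp θ' = NonUnitalStarAlgHom.id ℂ M :=
    (hM.existsUnique M ν hM.comp_eq).unique
      (fun i => by rw [NonUnitalStarAlgHom.comp_assoc, hθ', hθ]) fun i => rfl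
  refine ⟨StarAlgEquiv.ofNonUnitalStarAlgHom θ θ' h1 h2, fun i x => DFunLike.congr_fun (hθ i) x,
    fun e he => ?_⟩
  have := hu e.toNonUnitalStarAlgHom fun i => NonUnitalStarAlgHom.ext (he i)
  exact StarAlgEquiv.ext fun x => DFunLike.congr_fun this x

theorem theorem3p4 {G : Type v} [Group G]
    {A : ℕ → Type u} [∀ i, NonUnitalCStarAlgebra (A i)]
    (α : ∀ i, PartialAction G (A i))
    (φ : ∀ i, A i →⋆ₙₐ[ℂ] A (i + 1))
    (hφ : ∀ i, (α i).IsEquivariant (α (i + 1)) (φ i))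
    {L : Type u} [NonUnitalCStarAlgebra L] (μ : ∀ i, A i →⋆ₙₐ[ℂ] L)
    (hL : IsInductiveLimit.{u, u, u} φ μ) :
    (∃! β : PartialAction G L, IsInductiveLimitAction α μ β) ∧
    ∀ (β : PartialAction G L) (hβ : IsInductiveLimitAction α μ β),
      ∃ (ψ : ∀ i, (α i).CrossedProduct →⋆ₙₐ[ℂ] (α (i + 1)).CrossedProduct)
        (lam : ∀ i, (α i).CrossedProduct →⋆ₙₐ[ℂ] β.CrossedProduct),
        (∀ (i : ℕ) (g : G) (a : (α i).ideal g),
          ψ i (PartialAction.CrossedProduct.δ (α i) g a) =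
            PartialAction.CrossedProduct.δ (α (i + 1)) g ⟨φ i a, (hφ i).map_mem g a a.2⟩) ∧
        (∀ (i : ℕ) (g : G) (a : (α i).ideal g),
          lam i (PartialAction.CrossedProduct.δ (α i) g a) =
            PartialAction.CrossedProduct.δ β g ⟨μ i a, (hβ.equivariant i).map_mem g a a.2⟩) ∧
        IsInductiveLimit.{max u v, max u v, w} ψ lam ∧
        ∀ (M : Type (max u v)) [NonUnitalCStarAlgebra M]
          (ν : ∀ i, (α i).CrossedProduct →⋆ₙₐ[ℂ] M),
          IsInductiveLimit.{max u v, max u v, max u v} ψ ν →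
            ∃! θ : β.CrossedProduct ≃⋆ₐ[ℂ] M, ∀ i x, θ (lam i x) = ν i x := by
  refine ⟨PartialAction.existsUnique_isInductiveLimitAction hL hφ, fun β hβ => ?_⟩
  choose ψ hψ using fun i => (hφ i).exists_crossedProduct_hom
  choose lam hlam using fun i => (hβ.equivariant i).exists_crossedProduct_hom
  exact ⟨ψ, lam, hψ, hlam, hβ.isInductiveLimit_crossedProduct hL hφ hψ hlam, fun M _ ν hν =>
    (hβ.isInductiveLimit_crossedProduct hL hφ hψ hlam).existsUnique_starAlgEquiv hν⟩
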